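/- Let $g\ge 1$ be an integer and $n=g(g+1)/2$; identify $\mathrm{Sym}(g,\mathbb R)$ with $\mathbb R^n$ and $\mathrm{Sym}(g,\mathbb C)$ with $\mathbb C^n$, and let $\mathcal H_g\subseteq\mathbb C^n$ be the set of symmetric complex $g\times g$ matrices with positive definite imaginary part. For $(z,\tau)\in\mathbb C^g\times\mathcal H_g$ and $a,b\in\mathbb R^g$ put $$\vartheta(z,\tau)=\sum_{n\in\mathbb Z^g}\exp\bigl(\pi i({}^t n\,\tau\, n+2\,{}^t n\, z)\bigr),$$ $$\vartheta\left[{a\atop b}\right](z,\tau)=\exp\bigl(\pi i({}^t a\,\tau\, a+2\,{}^t a(z+b))\bigr)\,\vartheta(z+\tau a+b,\tau).$$ Let $\overline{\mathcal M}_g\subseteq \mathrm{Sym}(g,\mathbb R)$ be the closed cone of Minkowski reduced matrices, i.e. the set of real symmetric $\beta=(\beta_{i,j})$ such that $\beta_{1,1}\ge 0$; ${}^t a\,\beta\, a\ge\beta_{k,k}$ for all $1\le k\le g$ and all $a\in\mathbb Z^g$ with $\gcd(a_k,\dots,a_g)=1$; and $\beta_{k,k+1}\ge 0$ for $1\le k<g$.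 For $m>0$ let $$C_m=\{(y,\beta)\in\mathbb R^g\times \mathrm{Sym}(g,\mathbb R) : \beta\in\overline{\mathcal M}_g,\ |y_i|\le m\beta_{i,i}\ (1\le i\le g)\}.$$ For $d,R>0$ let $\mathcal T_{\le R}\bigl(C_m\cap\{\beta_{1,1}\ge d\}\bigr)$ be the set of $(z,\tau)\in\mathbb C^g\times\mathbb C^n$ with $(\mathrm{Im}\,z,\mathrm{Im}\,\tau)\in C_m$, $\mathrm{Im}\,\tau_{1,1}\ge d$, $|\mathrm{Re}\,z_i|\le R$ and $|\mathrm{Re}\,\tau_{i,j}|\le R$ for all $i,j$. Let $\mathbb R_{an,exp}$ be the ordered field of real numbers expanded by the real exponential function and by all restricted analytic functions (functions $\mathbb R^k\to\mathbb R$, $k \geq 0$, that agree on $[-1,1]^k$ with a function real analytic on a neighbourhood of $[-1,1]^k$ and vanish outside $[-1,1]^k$). A complex-valued function on a subset of $\mathbb C^N$ is definable if its graph, viewed in $\mathbb R^{2N+2}$ by real and imaginary parts, is definable with real parameters. Theorem. For all $a,b\in\mathbb R^g$ and all real $m,d,R>0$ there is an open set $U\subseteq\mathbb C^g\times\mathbb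 C^n$, contained in $\mathbb C^g\times\mathcal H_g$ and containing $\mathcal T_{\le R}\bigl(C_m\cap\{\beta_{1,1}\ge d\}\bigr)$, such that the restriction of $\vartheta\left[{a\atop b}\right]$ to $U$ is definable in $\mathbb R_{an,exp}$. -/

import Mathlib

open scoped Matrix

noncomputable section

namespace ThetaDef

/-! The structure of the real field with restricted analytic functions and exponentiation. -/

/-- Function symbols of the language of `ℝ_{an,exp}`: the ordered field symbols, a symbol for the
exponential function, and a symbol for each function of `n` real variables that is real analytic
on a neighbourhood of the cube `[-1,1]^n`. -/
inductive RanExpFunc : ℕ → Type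
  | zero : RanExpFunc 0
  | one : RanExpFunc 0
  | neg : RanExpFunc 1
  | add : RanExpFunc 2
  | mul : RanExpFunc 2
  | exp : RanExpFunc 1
  | an {n : ℕ} (f : (Fin n → ℝ) → ℝ) (hf : AnalyticOnNhd ℝ f (Set.Icc (-1) 1)) : RanExpFunc n

/-- Relation symbols of the language of `ℝ_{an,exp}`: the order. -/
inductive RanExpRel : ℕ → Type
  | lt : RanExpRel 2

/-- The language of `ℝ_{an,exp}`. -/
def ranExp : FirstOrder.Language.{0, 0} where
  Functions := RanExpFunc
  Relations := RanExpRel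

/-- Interpretation of the function symbols. A restricted analytic function is given by `f` on the
cube `[-1,1]^n`, and is `0` outside of the cube. -/
def RanExpFunc.interp : {n : ℕ} → RanExpFunc n → (Fin n → ℝ) → ℝ
  | _, .zero, _ => 0
  | _, .one, _ => 1
  | _, .neg, x => - x 0
  | _, .add, x => x 0 + x 1
  | _, .mul, x => x 0 * x 1
  | _, .exp, x => Real.exp (x 0)
  | _, .an f _, x => Set.indicator (Set.Icc (-1) 1) f x

/-- Interpretation of the relation symbols. -/
def RanExpRel.interp : {n : ℕ} → RanExpRel n → (Fin n → ℝ) → Prop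
  | _, .lt, x => x 0 < x 1

/-- The structure `ℝ_{an,exp}`. -/
instance instStructureReal : ranExp.Structure ℝ where
  funMap := RanExpFunc.interp
  RelMap := RanExpRel.interp

/-- The identification of `ℂ^ι` with `ℝ^ι × ℝ^ι` by real and imaginary parts. -/
def realCoords {ι : Type*} (w : ι → ℂ) : ι ⊕ ι → ℝ :=
  Sum.elim (fun i => (w i).re) (fun i => (w i).im)

/-- The graph of the restriction of `f` to `U`, as a subset of a real affine space. -/
def realGraphOn {α β : Type*} (f : (α → ℂ) → (β → ℂ) → ℂ) (U : Set ((α → ℂ) × (β → ℂ))) :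
    Set (((α ⊕ β) ⊕ Unit) ⊕ ((α ⊕ β) ⊕ Unit) → ℝ) :=
  {v | ∃ p ∈ U, v = realCoords (Sum.elim (Sum.elim p.1 p.2) (fun _ => f p.1 p.2))}

/-- The restriction of `f` to `U` is definable (with real parameters) in `ℝ_{an,exp}`. -/
def DefinableOn {α β : Type*} (f : (α → ℂ) → (β → ℂ) → ℂ) (U : Set ((α → ℂ) × (β → ℂ))) : Prop :=
  (Set.univ : Set ℝ).Definable ranExp (realGraphOn f U)

/-! Symmetric matrices. A symmetric `g × g` matrix is a function on unordered pairs of indices,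
so `Sym2 (Fin g) → R` is `Sym(g, R)`, identified with `R^n` for `n = g (g + 1) / 2`. -/

/-- The symmetric matrix with entries `t s(i, j)`. -/
def symMatrix {R : Type*} {g : ℕ} (t : Sym2 (Fin g) → R) : Matrix (Fin g) (Fin g) R :=
  Matrix.of fun i j => t s(i, j)

/-- `M[a] = ᵗa M a`. -/
def quadForm {R : Type*} [CommRing R] {g : ℕ} (M : Matrix (Fin g) (Fin g) R) (a : Fin g → R) : R :=
  a ⬝ᵥ (M *ᵥ a)

/-- The Siegel upper half-space of degree `g`. -/
def siegel (g : ℕ) : Set (Sym2 (Fin g) → ℂ) :=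
  {t | (symMatrix fun e => (t e).im).PosDef}

/-- The closed cone of Minkowski reduced matrices: `β₁₁ ≥ 0`; `β[a] ≥ βₖₖ` for all `k` and all
integral `a` with `gcd(aₖ, …, a_g) = 1`; and `βₖ,ₖ₊₁ ≥ 0` for `k < g`. (The Minkowski reduced
matrices are those of its elements that satisfy `β₁₁ > 0`.) -/
def minkowskiCone (g : ℕ) [NeZero g] : Set (Sym2 (Fin g) → ℝ) :=
  {b | 0 ≤ symMatrix b 0 0 ∧
    (∀ (k : Fin g) (a : Fin g → ℤ), (Finset.Ici k).gcd a = 1 →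
      symMatrix b k k ≤ quadForm (symMatrix b) (fun i => (a i : ℝ))) ∧
    (∀ i j : Fin g, (i : ℕ) + 1 = (j : ℕ) → 0 ≤ symMatrix b i j)}

/-- The cone `C_m` of pairs `(y, β)` with `β` in the closed Minkowski cone and `|yᵢ| ≤ m βᵢᵢ`. -/
def coneC (g : ℕ) [NeZero g] (m : ℝ) : Set ((Fin g → ℝ) × (Sym2 (Fin g) → ℝ)) :=
  {p | p.2 ∈ minkowskiCone g ∧ ∀ i, |p.1 i| ≤ m * symMatrix p.2 i i}

/-- The part `β₁₁ ≥ d` of `C_m`. -/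
def coneCGe (g : ℕ) [NeZero g] (m d : ℝ) : Set ((Fin g → ℝ) × (Sym2 (Fin g) → ℝ)) :=
  {p | p ∈ coneC g m ∧ d ≤ symMatrix p.2 0 0}

/-- The truncated tube domain `T_{≤ R}(S)`: imaginary part in `S`, and all real parts of the
coordinates at most `R` in absolute value. -/
def truncTube {α β : Type*} (R : ℝ) (S : Set ((α → ℝ) × (β → ℝ))) :
    Set ((α → ℂ) × (β → ℂ)) :=
  {p | (∀ i, |(p.1 i).re| ≤ R) ∧ (∀ j, |(p.2 j).re| ≤ R) ∧
    ((fun i => (p.1 i).im), (fun j => (p.2 j).im)) ∈ S}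

/-- The Riemann theta function
`ϑ(z, τ) = ∑_{n ∈ ℤ^g} exp(π i (ᵗn τ n + 2 ᵗn z))`, for `τ` in the Siegel upper half-space. -/
def theta {g : ℕ} (z : Fin g → ℂ) (t : Sym2 (Fin g) → ℂ) : ℂ :=
  ∑' n : Fin g → ℤ, Complex.exp (Real.pi * Complex.I *
    (quadForm (symMatrix t) (fun i => (n i : ℂ)) + 2 * ((fun i => (n i : ℂ)) ⬝ᵥ z)))

/-- The theta function with real characteristics `a, b`:
`ϑ[a,b](z, τ) = exp(π i (ᵗa τ a + 2 ᵗa (z + b))) ϑ(z + τ a + b, τ)`. -/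
def thetaChar {g : ℕ} (a b : Fin g → ℝ) (z : Fin g → ℂ) (t : Sym2 (Fin g) → ℂ) : ℂ :=
  Complex.exp (Real.pi * Complex.I *
    (quadForm (symMatrix t) (fun i => (a i : ℂ)) +
      2 * ((fun i => (a i : ℂ)) ⬝ᵥ (z + fun i => (b i : ℂ))))) *
  theta (z + symMatrix t *ᵥ (fun i => (a i : ℂ)) + fun i => (b i : ℂ)) t

end ThetaDef

end

noncomputable section

namespace ThetaDef

/-! ### Power series in several variables -/

/-! On a region where finitely many real affine functionals `l j` have bounded real part and
imaginary part bounded below, a convergent power series in the variables `exp (π i l j)` is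
definable. The modulus `exp (-π Im l j)` is a bounded real exponential and the argument `π Re l j`
is bounded, so in polar coordinates the series becomes a restricted analytic function. A factor `exp
(π i A)` in front is harmless if `Re A` is bounded, since its modulus is a real exponential. This is
`definableOn_exp_mul_tsum`. It remains to cover the truncated tube by finitely many such regions on
which theta is such a series.

Reduction theory gives `β[x] ≥ c ∑ x i ^ 2 * β i i` with `c` depending only on `g`
(`exists_lower_bound`). Hence the Gram–Schmidt coefficients of the standard basis are bounded.
Rounding them to a fine rational grid leaves finitely many unipotent rational `P` such that, for
every reduced `β` and a suitable one of them, the off-diagonal entries of `ᵗP β P` are at most a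
small multiple of `β i i` (`exists_finite_nearly_orthogonal`).

Fix such a `P`, with `A P = N` and `A` integral, and put `Q = P / N`, `μ = A n`, `σ = ᵗQ τ Q`, `ζ =
ᵗQ (z + τ a + b)`. Up to a shift independent of `n`, the exponent `σ[μ] + 2 ᵗμ ζ` is a combination,
with coefficients in `ℕ`, of `u i = σ i i / (2g + 2)`, `M u i ± ζ i` and `u i ± σ i j`
(`sum_genExponent_mul_gen`). Near orthogonality makes the imaginary parts of the last two kinds
nonnegative, while `Im u i` is bounded below by a positive multiple of `d`. The coefficient of `u i`
is at least `μ i ^ 2`, so the series still converges on a polydisc with radii slightly above `1` in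
the other variables. This slack makes the region open, and diagonal dominance keeps it inside the
Siegel space (`exists_definable_neighborhood`). -/

theorem exists_fin_prod_eq_prod_pow {J : Type*} [Fintype J] (k : J → ℕ) :
    ∃ σ : Fin (∑ j, k j) → J, ∀ x : J → ℂ, ∏ i, x (σ i) = ∏ j, x j ^ k j := by
  have hc : Fintype.card (Σ j, Fin (k j)) = ∑ j, k j := by simp
  refine ⟨fun i => ((Fintype.equivFinOfCardEq hc).symm i).1, fun x => ?_⟩
  rw [(Fintype.equivFinOfCardEq hc).symm.prod_comp (fun s : Σ j, Fin (k j) => x s.1),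
    Fintype.prod_sigma]
  simp

/-- The degree `D` is left free, with value zero in the wrong degree, so that a family of monomials
can be summed degree by degree. -/
theorem exists_monomial_multilinear {J : Type*} [Fintype J] (k : J → ℕ) (D : ℕ) :
    ∃ p : ContinuousMultilinearMap ℂ (fun _ : Fin D => (J → ℂ)) ℂ, ‖p‖ ≤ 1 ∧
      ∀ x : J → ℂ, p (fun _ => x) = if D = ∑ j, k j then ∏ j, x j ^ k j else 0 := by
  by_cases h : D = ∑ j, k j
  · subst h
    obtain ⟨σ, hσ⟩ := exists_fin_prod_eq_prod_pow k
    refine ⟨(ContinuousMultilinearMap.mkPiAlgebra ℂ _ ℂ).compContinuousLinearMap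
      fun i => ContinuousLinearMap.proj (σ i), ?_, fun x => ?_⟩
    · refine (ContinuousMultilinearMap.norm_compContinuousLinearMap_le _ _).trans ?_
      rw [ContinuousMultilinearMap.norm_mkPiAlgebra, one_mul]
      refine Finset.prod_le_one (fun _ _ => norm_nonneg _) fun i _ => ?_
      refine ContinuousLinearMap.opNorm_le_bound _ zero_le_one fun x => ?_
      simpa using norm_le_pi_norm x (σ i)
    · simp [hσ]
  · exact ⟨0, by simp, fun x => by simp [h]⟩

/-- Grouping the monomials by total degree gives a formal multilinear series whose terms are all
bounded by `∑ ‖c n‖`. The exponent map need not be injective, so the theta series can be fed in with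
its own index set. -/
theorem analyticOnNhd_tsum_monomial_unit {J ν : Type*} [Fintype J] (k : ν → J → ℕ) (c : ν → ℂ)
    (hc : Summable fun n => ‖c n‖) :
    AnalyticOnNhd ℂ (fun x : J → ℂ => ∑' n, c n * ∏ j, x j ^ k n j) (Metric.ball 0 1) := by
  choose p hp hpx using fun n D => exists_monomial_multilinear (k n) D
  let q : FormalMultilinearSeries ℂ (J → ℂ) ℂ := fun D => ∑' n, c n • p n D
  have hs : ∀ D, Summable fun n => c n • p n D := fun D =>
    Summable.of_norm_bounded hc fun n => by
      rw [norm_smul]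
      exact mul_le_of_le_one_right (norm_nonneg _) (hp n D)
  have hq : ∀ D, ‖q D‖ ≤ ∑' n, ‖c n‖ := fun D =>
    tsum_of_norm_bounded hc.hasSum fun n => by
      rw [norm_smul]
      exact mul_le_of_le_one_right (norm_nonneg _) (hp n D)
  have hball : HasFPowerSeriesOnBall (fun x : J → ℂ => ∑' n, c n * ∏ j, x j ^ k n j) q 0 1 := by
    refine ⟨?_, one_pos, fun {y} hy => ?_⟩
    · have := q.le_radius_of_bound (r := 1) (∑' n, ‖c n‖) fun D => by simpa using hq D
      simpa using this
    · have hy1 : ‖y‖ ≤ 1 := by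
        have : edist y 0 < 1 := hy
        rw [edist_zero_right, ← ofReal_norm] at this
        have := (ENNReal.ofReal_lt_one).1 this
        exact this.le
      have hterm : ∀ n, ‖c n * ∏ j, y j ^ k n j‖ ≤ ‖c n‖ := fun n => by
        rw [norm_mul, norm_prod]
        refine mul_le_of_le_one_right (norm_nonneg _) (Finset.prod_le_one (fun _ _ => norm_nonneg _)
          fun j _ => ?_)
        rw [norm_pow]
        exact pow_le_one₀ (norm_nonneg _) ((norm_le_pi_norm y j).trans hy1)
      have h1 : HasSum (fun n => c n * ∏ j, y j ^ k n j) (∑' n, c n * ∏ j, y j ^ k n j) :=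
        (Summable.of_norm_bounded hc hterm).hasSum
      let f : ν × ℕ → ℂ := fun s => c s.1 * p s.1 s.2 fun _ => y
      -- The double family over pairs `(n, D)` is supported on the graph of the total degree; it is
      -- summed over `n` here and then refibred over `D`.
      have hinj : Function.Injective (fun n : ν => (n, ∑ j, k n j)) :=
        fun a b h => congrArg Prod.fst h
      have h2 : HasSum f (∑' n, c n * ∏ j, y j ^ k n j) := by
        rw [← hinj.hasSum_iff]
        · convert h1 using 2 with n
          simp [f, hpx]
        · rintro ⟨n, D⟩ hx
          have : D ≠ ∑ j, k n j := fun h => hx ⟨n, by simp [h]⟩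
          simp [f, hpx, this]
      have h3 := ((Equiv.prodComm ℕ ν).hasSum_iff.2 h2).prod_fiberwise
        (g := fun D => q D fun _ => y) fun D => by
          have := (hs D).hasSum.mapL (ContinuousMultilinearMap.apply ℂ (fun _ : Fin D => (J → ℂ)) ℂ
            (fun _ => y))
          simpa [f, q] using this
      simpa using h3
  intro x hx
  refine hball.analyticOnNhd x ?_
  rw [← Metric.eball_ofReal] at hx
  simpa using hx

theorem analyticOnNhd_tsum_monomial {J ν : Type*} [Fintype J] (k : ν → J → ℕ) (ρ : J → ℝ)
    (hρ : ∀ j, 0 < ρ j) (hs : Summable fun n => ∏ j, ρ j ^ k n j) :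
    AnalyticOnNhd ℂ (fun x : J → ℂ => ∑' n, ∏ j, x j ^ k n j) {x | ∀ j, ‖x j‖ < ρ j} := by
  have h1 := analyticOnNhd_tsum_monomial_unit k (fun n => ((∏ j, ρ j ^ k n j : ℝ) : ℂ))
    (hs.congr fun n => by
      rw [Complex.norm_real, Real.norm_of_nonneg]
      exact Finset.prod_nonneg fun j _ => pow_nonneg (hρ j).le _)
  have h2 : AnalyticOnNhd ℂ (fun x : J → ℂ => fun j => x j / (ρ j : ℂ))
      {x | ∀ j, ‖x j‖ < ρ j} := by
    refine AnalyticOnNhd.pi fun j => ?_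
    exact ((ContinuousLinearMap.proj (R := ℂ) (φ := fun _ : J => ℂ) j).analyticOnNhd _).div_const
  have h3 := h1.comp h2 fun x hx => by
    rw [mem_ball_zero_iff, pi_norm_lt_iff one_pos]
    intro j
    rw [norm_div, Complex.norm_real, Real.norm_of_nonneg (hρ j).le, div_lt_one (hρ j)]
    exact hx j
  convert h3 using 1
  funext x
  refine tsum_congr fun n => ?_
  simp only [Complex.ofReal_prod, Complex.ofReal_pow]
  rw [← Finset.prod_mul_distrib]
  refine Finset.prod_congr rfl fun j _ => ?_
  have : (ρ j : ℂ) ≠ 0 := by exact_mod_cast (hρ j).ne'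
  rw [← mul_pow, mul_div_cancel₀ _ this]

/-! ### Terms of the language of `ℝ_{an,exp}` -/

section

open FirstOrder

/-- `f` is given by a term of the language of `ℝ_{an,exp}` with real parameters. -/
def IsTermFun {ι : Type*} (f : (ι → ℝ) → ℝ) : Prop :=
  ∃ t : (ranExp[[(Set.univ : Set ℝ)]]).Term ι, ∀ v, t.realize v = f v

namespace IsTermFun

variable {ι : Type*} {f h : (ι → ℝ) → ℝ}

theorem coord (i : ι) : IsTermFun fun v : ι → ℝ => v i := ⟨Language.Term.var i, fun _ => rfl⟩

theorem const (c : ℝ) : IsTermFun fun _ : ι → ℝ => c :=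
  ⟨(ranExp.con (⟨c, trivial⟩ : (Set.univ : Set ℝ))).term, fun v => by simp⟩

theorem funMap {n : ℕ} (F : RanExpFunc n) {f : Fin n → (ι → ℝ) → ℝ} (hf : ∀ i, IsTermFun (f i)) :
    IsTermFun fun v => F.interp fun i => f i v := by
  choose t ht using hf
  refine ⟨Language.Term.func (Sum.inl F : (ranExp[[(Set.univ : Set ℝ)]]).Functions n) t,
    fun v => ?_⟩
  simp only [Language.Term.realize, ht]
  exact Language.withConstants_funMap_sumInl (L := ranExp) (f := F)

theorem add (hf : IsTermFun f) (hh : IsTermFun h) : IsTermFun fun v => f v + h v :=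
  funMap RanExpFunc.add (f := ![f, h]) (Fin.forall_fin_two.2 ⟨hf, hh⟩)

theorem mul (hf : IsTermFun f) (hh : IsTermFun h) : IsTermFun fun v => f v * h v :=
  funMap RanExpFunc.mul (f := ![f, h]) (Fin.forall_fin_two.2 ⟨hf, hh⟩)

theorem neg (hf : IsTermFun f) : IsTermFun fun v => - f v :=
  funMap RanExpFunc.neg (f := ![f]) (fun _ => by simpa using hf)

theorem exp (hf : IsTermFun f) : IsTermFun fun v => Real.exp (f v) :=
  funMap RanExpFunc.exp (f := ![f]) (fun _ => by simpa using hf)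

theorem sum {κ : Type*} (s : Finset κ) {f : κ → (ι → ℝ) → ℝ} (hf : ∀ i, IsTermFun (f i)) :
    IsTermFun fun v => ∑ i ∈ s, f i v := by
  classical
  induction s using Finset.induction_on with
  | empty => simpa using const 0
  | insert a s ha ih => simpa [Finset.sum_insert ha] using (hf a).add ih

theorem restricted {κ : Type*} [Fintype κ] {F : (κ → ℝ) → ℝ}
    (hF : AnalyticOnNhd ℝ F (Set.Icc (-1) 1)) {f : κ → (ι → ℝ) → ℝ} (hf : ∀ i, IsTermFun (f i)) :
    IsTermFun fun v => Set.indicator (Set.Icc (-1) 1) F fun i => f i v := by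
  let e := Fintype.equivFin κ
  let F' : (Fin (Fintype.card κ) → ℝ) → ℝ := fun u => F fun i => u (e i)
  have hF' : AnalyticOnNhd ℝ F' (Set.Icc (-1) 1) := by
    refine hF.comp (AnalyticOnNhd.pi fun j =>
      (ContinuousLinearMap.proj (R := ℝ) (φ := fun _ => ℝ) (e j)).analyticOnNhd _) ?_
    exact fun u hu => ⟨fun i => hu.1 (e i), fun i => hu.2 (e i)⟩
  have h := funMap (RanExpFunc.an F' hF') (f := fun i => f (e.symm i)) fun i => hf _
  convert h using 2 with v
  have hiff : ((fun i => f i v) ∈ Set.Icc (-1 : κ → ℝ) 1) ↔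
      ((fun i => f (e.symm i) v) ∈ Set.Icc (-1 : Fin (Fintype.card κ) → ℝ) 1) := by
    constructor
    · exact fun hu => ⟨fun i => hu.1 (e.symm i), fun i => hu.2 (e.symm i)⟩
    · intro hu
      refine ⟨fun i => ?_, fun i => ?_⟩
      · simpa using hu.1 (e i)
      · simpa using hu.2 (e i)
  by_cases hm : (fun i => f i v) ∈ Set.Icc (-1 : κ → ℝ) 1
  · simp [RanExpFunc.interp, Set.indicator_of_mem hm, Set.indicator_of_mem (hiff.1 hm), F']
  · simp [RanExpFunc.interp, Set.indicator_of_notMem hm, Set.indicator_of_notMem (mt hiff.2 hm)]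

theorem definable_lt (hf : IsTermFun f) (hh : IsTermFun h) :
    (Set.univ : Set ℝ).Definable ranExp {v | f v < h v} := by
  obtain ⟨s, hs⟩ := hf
  obtain ⟨t, ht⟩ := hh
  refine ⟨Language.Relations.formula₂
    (Sum.inl RanExpRel.lt : (ranExp[[(Set.univ : Set ℝ)]]).Relations 2) s t, ?_⟩
  ext v
  refine (Iff.trans Language.Formula.realize_rel₂ ?_).symm
  rw [hs, ht]
  exact iff_of_eq (Language.withConstants_relMap_sumInl (L := ranExp) (R := RanExpRel.lt))

theorem definable_eq (hf : IsTermFun f) (hh : IsTermFun h) :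
    (Set.univ : Set ℝ).Definable ranExp {v | f v = h v} := by
  obtain ⟨s, hs⟩ := hf
  obtain ⟨t, ht⟩ := hh
  refine ⟨s.equal t, ?_⟩
  ext v
  simp [hs, ht]

end IsTermFun

end

/-! ### Real affine functionals -/

/-- Affine functionals of complex variables with real coefficients. -/
def IsRealAffine {α β : Type*} [Fintype α] [Fintype β] (l : (α → ℂ) × (β → ℂ) → ℂ) : Prop :=
  ∃ (c : α → ℝ) (d : β → ℝ) (r : ℝ), ∀ p, l p = ∑ i, c i * p.1 i + ∑ j, d j * p.2 j + r

namespace IsRealAffine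

variable {α β : Type*} [Fintype α] [Fintype β] {l l' : (α → ℂ) × (β → ℂ) → ℂ}

theorem fst (i : α) : IsRealAffine fun p : (α → ℂ) × (β → ℂ) => p.1 i := by
  classical
  exact ⟨Pi.single i 1, 0, 0, fun p => by simp [Pi.single_apply, apply_ite, ite_mul]⟩

theorem snd (i : β) : IsRealAffine fun p : (α → ℂ) × (β → ℂ) => p.2 i := by
  classical
  exact ⟨0, Pi.single i 1, 0, fun p => by simp [Pi.single_apply, apply_ite, ite_mul]⟩

theorem const (r : ℝ) : IsRealAffine fun _ : (α → ℂ) × (β → ℂ) => (r : ℂ) :=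
  ⟨0, 0, r, fun p => by simp⟩

theorem add (h : IsRealAffine l) (h' : IsRealAffine l') : IsRealAffine fun p => l p + l' p := by
  obtain ⟨c, d, r, h⟩ := h
  obtain ⟨c', d', r', h'⟩ := h'
  refine ⟨c + c', d + d', r + r', fun p => ?_⟩
  simp only [h, h', Pi.add_apply, Complex.ofReal_add, add_mul, Finset.sum_add_distrib]
  ring

theorem smul (s : ℝ) (h : IsRealAffine l) : IsRealAffine fun p => (s : ℂ) * l p := by
  obtain ⟨c, d, r, h⟩ := h
  refine ⟨s • c, s • d, s * r, fun p => ?_⟩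
  simp only [h, Pi.smul_apply, smul_eq_mul, Complex.ofReal_mul, mul_add, Finset.mul_sum, mul_assoc]

theorem sum {κ : Type*} (s : Finset κ) {l : κ → (α → ℂ) × (β → ℂ) → ℂ}
    (h : ∀ i, IsRealAffine (l i)) : IsRealAffine fun p => ∑ i ∈ s, l i p := by
  classical
  induction s using Finset.induction_on with
  | empty => simpa using const 0
  | insert a s ha ih => simpa [Finset.sum_insert ha] using (h a).add ih

theorem continuous (h : IsRealAffine l) : Continuous l := by
  obtain ⟨c, d, r, h⟩ := h
  rw [funext h]
  fun_prop

theorem isTermFun_re (h : IsRealAffine l) :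
    IsTermFun fun v : ((α ⊕ β) ⊕ Unit) ⊕ ((α ⊕ β) ⊕ Unit) → ℝ =>
      (l (fun i => ⟨v (.inl (.inl (.inl i))), v (.inr (.inl (.inl i)))⟩,
        fun i => ⟨v (.inl (.inl (.inr i))), v (.inr (.inl (.inr i)))⟩)).re := by
  obtain ⟨c, d, r, h⟩ := h
  simp only [h, Complex.add_re, Complex.re_sum, Complex.re_ofReal_mul, Complex.ofReal_re]
  exact ((IsTermFun.sum _ fun i => (IsTermFun.const _).mul (IsTermFun.coord _)).add
    (IsTermFun.sum _ fun i => (IsTermFun.const _).mul (IsTermFun.coord _))).add (IsTermFun.const _)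

theorem isTermFun_im (h : IsRealAffine l) :
    IsTermFun fun v : ((α ⊕ β) ⊕ Unit) ⊕ ((α ⊕ β) ⊕ Unit) → ℝ =>
      (l (fun i => ⟨v (.inl (.inl (.inl i))), v (.inr (.inl (.inl i)))⟩,
        fun i => ⟨v (.inl (.inl (.inr i))), v (.inr (.inl (.inr i)))⟩)).im := by
  obtain ⟨c, d, r, h⟩ := h
  simp only [h, Complex.add_im, Complex.im_sum, Complex.im_ofReal_mul, Complex.ofReal_im]
  exact ((IsTermFun.sum _ fun i => (IsTermFun.const _).mul (IsTermFun.coord _)).add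
    (IsTermFun.sum _ fun i => (IsTermFun.const _).mul (IsTermFun.coord _))).add (IsTermFun.const _)

end IsRealAffine

/-- The point of `ℂ^α × ℂ^β` with the coordinates of a point of the real ambient space of graphs. -/
def ofRealCoords {α β : Type*} (v : ((α ⊕ β) ⊕ Unit) ⊕ ((α ⊕ β) ⊕ Unit) → ℝ) :
    (α → ℂ) × (β → ℂ) :=
  (fun i => ⟨v (.inl (.inl (.inl i))), v (.inr (.inl (.inl i)))⟩,
    fun i => ⟨v (.inl (.inl (.inr i))), v (.inr (.inl (.inr i)))⟩)

/-- The point of the domain can be read off from the coordinates of a graph point, so the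
existential quantifier disappears and the graph is cut out by conditions on terms. -/
theorem realGraphOn_eq {α β : Type*} (f : (α → ℂ) → (β → ℂ) → ℂ)
    (U : Set ((α → ℂ) × (β → ℂ))) :
    realGraphOn f U = {v | ofRealCoords v ∈ U} ∩
      ({v | v (.inl (.inr ())) = (f (ofRealCoords v).1 (ofRealCoords v).2).re} ∩
        {v | v (.inr (.inr ())) = (f (ofRealCoords v).1 (ofRealCoords v).2).im}) := by
  ext v
  constructor
  · rintro ⟨p, hp, rfl⟩
    have : ofRealCoords (realCoords (Sum.elim (Sum.elim p.1 p.2) fun _ : Unit => f p.1 p.2)) = p :=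
      rfl
    simp only [Set.mem_inter_iff, Set.mem_ofPred_eq, this]
    exact ⟨hp, rfl, rfl⟩
  · rintro ⟨h1, h2, h3⟩
    refine ⟨_, h1, ?_⟩
    funext i
    rcases i with ((i | i) | i) | ((i | i) | i)
    · rfl
    · rfl
    · exact h2
    · rfl
    · rfl
    · exact h3

/-! ### Definability of exponential power series -/

/-- The exponential power series in polar coordinates: the coordinates are the moduli of the
variables, divided by `ρ`, and the arguments of the variables and of the factor in front, divided
by `π R`. -/
def polarSeries {J ν : Type*} [Fintype J] (k : ν → J → ℕ) (ρ : J → ℝ) (R : ℝ)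
    (u : (J ⊕ J) ⊕ Unit → ℝ) : ℂ :=
  Complex.exp (Real.pi * Complex.I * (R * u (.inr ()) : ℝ)) *
    ∑' n, ∏ j, ((ρ j * u (.inl (.inl j)) : ℝ) *
      Complex.exp (Real.pi * Complex.I * (R * u (.inl (.inr j)) : ℝ))) ^ k n j

theorem norm_exp_pi_mul_I (x : ℝ) : ‖Complex.exp (Real.pi * Complex.I * (x : ℂ))‖ = 1 := by
  rw [Complex.norm_exp]
  simp

/-- The strict inequality `ρ j < ρ' j` provides analyticity on a neighbourhood of the closed cube.
Negative values of the modulus coordinates cause no trouble, since only absolute values enter. -/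
theorem analyticOnNhd_polarSeries {J ν : Type*} [Fintype J] (k : ν → J → ℕ) (ρ ρ' : J → ℝ) (R : ℝ)
    (hρ : ∀ j, 0 < ρ j) (hρ' : ∀ j, ρ j < ρ' j) (hs : Summable fun n => ∏ j, ρ' j ^ k n j) :
    AnalyticOnNhd ℝ (polarSeries k ρ R) (Set.Icc (-1) 1) := by
  have hcoord : ∀ (c : ℝ) (i : (J ⊕ J) ⊕ Unit), AnalyticOnNhd ℝ
      (fun u : (J ⊕ J) ⊕ Unit → ℝ => ((c * u i : ℝ) : ℂ)) (Set.Icc (-1) 1) := fun c i =>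
    (Complex.ofRealCLM.comp (c • ContinuousLinearMap.proj (R := ℝ)
      (φ := fun _ : (J ⊕ J) ⊕ Unit => ℝ) i)).analyticOnNhd _
  have hexp : ∀ i : (J ⊕ J) ⊕ Unit, AnalyticOnNhd ℝ (fun u : (J ⊕ J) ⊕ Unit → ℝ =>
      Complex.exp (Real.pi * Complex.I * (R * u i : ℝ))) (Set.Icc (-1) 1) := fun i =>
    (analyticOnNhd_cexp.restrictScalars (𝕜 := ℝ)).comp
      (analyticOnNhd_const.mul (hcoord R i)) (fun _ _ => trivial)
  have hF := (analyticOnNhd_tsum_monomial k ρ' (fun j => (hρ j).trans (hρ' j)) hs).restrictScalars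
    (𝕜 := ℝ)
  refine (hexp _).mul (hF.comp (AnalyticOnNhd.pi fun j => (hcoord _ _).mul (hexp _)) ?_)
  intro u hu j
  rw [norm_mul, norm_exp_pi_mul_I, mul_one, Complex.norm_real, norm_mul,
    Real.norm_of_nonneg (hρ j).le]
  refine lt_of_le_of_lt (mul_le_of_le_one_right (hρ j).le ?_) (hρ' j)
  exact abs_le.2 ⟨hu.1 _, hu.2 _⟩

theorem exp_pi_mul_I_eq (w : ℂ) : Complex.exp (Real.pi * Complex.I * w) =
    (Real.exp (- (Real.pi * w.im)) : ℝ) * Complex.exp (Real.pi * Complex.I * (w.re : ℂ)) := by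
  rw [Complex.ofReal_exp, ← Complex.exp_add]
  congr 1
  apply Complex.ext <;> simp

/-- On `U` the normalized moduli and arguments lie in the cube, so `f` is a real exponential times a
restricted analytic function composed with terms. The imaginary part of `A` may be unbounded: it
enters only through the real exponential. -/
theorem definableOn_exp_mul_tsum {α β J ν : Type*} [Fintype α] [Fintype β] [Fintype J]
    {A : (α → ℂ) × (β → ℂ) → ℂ} (hA : IsRealAffine A)
    {l : J → (α → ℂ) × (β → ℂ) → ℂ} (hl : ∀ j, IsRealAffine (l j))
    (k : ν → J → ℕ) {lam lam' : J → ℝ} (hlam : ∀ j, lam j < lam' j)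
    (hs : Summable fun n => ∏ j, Real.exp (Real.pi * lam' j) ^ k n j) {R : ℝ} (hR : 0 < R)
    {f : (α → ℂ) → (β → ℂ) → ℂ} {U : Set ((α → ℂ) × (β → ℂ))}
    (hU : U = {p | (∀ j, (- lam j < (l j p).im ∧ |(l j p).re| < R)) ∧ |(A p).re| < R})
    (hf : ∀ p ∈ U, f p.1 p.2 = Complex.exp (Real.pi * Complex.I * A p) *
      ∑' n, ∏ j, Complex.exp (Real.pi * Complex.I * l j p) ^ k n j) :
    IsOpen U ∧ DefinableOn f U := by
  have hρ : ∀ j, Real.exp (Real.pi * lam j) < Real.exp (Real.pi * lam' j) := fun j =>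
    Real.exp_lt_exp.2 (mul_lt_mul_of_pos_left (hlam j) Real.pi_pos)
  have han := analyticOnNhd_polarSeries k (fun j => Real.exp (Real.pi * lam j)) _ R
    (fun j => Real.exp_pos _) hρ hs
  set G := polarSeries k (fun j => Real.exp (Real.pi * lam j)) R with hG
  have hre : AnalyticOnNhd ℝ (fun u => (G u).re) (Set.Icc (-1) 1) :=
    (Complex.reCLM.analyticOnNhd Set.univ).comp han fun _ _ => trivial
  have him : AnalyticOnNhd ℝ (fun u => (G u).im) (Set.Icc (-1) 1) :=
    (Complex.imCLM.analyticOnNhd Set.univ).comp han fun _ _ => trivial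
  let arg : (J ⊕ J) ⊕ Unit → (α → ℂ) × (β → ℂ) → ℝ := Sum.elim
    (Sum.elim (fun j p => Real.exp (- Real.pi * ((l j p).im + lam j)))
      (fun j p => R⁻¹ * (l j p).re)) (fun _ p => R⁻¹ * (A p).re)
  have harg : ∀ i, IsTermFun fun v : ((α ⊕ β) ⊕ Unit) ⊕ ((α ⊕ β) ⊕ Unit) → ℝ =>
      arg i (ofRealCoords v) := by
    rintro ((j | j) | j)
    · exact ((IsTermFun.const _).mul ((hl j).isTermFun_im.add (IsTermFun.const _))).exp
    · exact (IsTermFun.const _).mul (hl j).isTermFun_re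
    · exact (IsTermFun.const _).mul hA.isTermFun_re
  have hmem : ∀ p ∈ U, (fun i => arg i p) ∈ Set.Icc (-1 : (J ⊕ J) ⊕ Unit → ℝ) 1 := by
    intro p hp
    rw [hU] at hp
    have hb : ∀ x : ℝ, |x| < R → |R⁻¹ * x| ≤ 1 := fun x hx => by
      rw [abs_mul, abs_of_pos (inv_pos.2 hR), inv_mul_le_one₀ hR]
      exact hx.le
    have key : ∀ i, |arg i p| ≤ 1 := by
      rintro ((j | j) | j)
      · simp only [arg, Sum.elim_inl, Real.abs_exp]
        rw [Real.exp_le_one_iff]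
        nlinarith [Real.pi_pos, (hp.1 j).1]
      · exact hb _ (hp.1 j).2
      · exact hb _ hp.2
    exact ⟨fun i => (abs_le.1 (key i)).1, fun i => (abs_le.1 (key i)).2⟩
  have hval : ∀ p ∈ U, f p.1 p.2 =
      (Real.exp (- (Real.pi * (A p).im)) : ℝ) * G fun i => arg i p := by
    intro p hp
    rw [hf p hp, exp_pi_mul_I_eq (A p), mul_assoc]
    have hRR : ∀ x : ℝ, R * (R⁻¹ * x) = x := fun x => by field_simp
    simp only [hG, polarSeries, arg, Sum.elim_inr, Sum.elim_inl, hRR]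
    congr 2
    refine tsum_congr fun n => Finset.prod_congr rfl fun j _ => ?_
    rw [exp_pi_mul_I_eq (l j p), ← Real.exp_add]
    congr 4
    ring
  constructor
  · have hc := fun j => (hl j).continuous
    have hcA := hA.continuous
    rw [hU, Set.ofPred_and, Set.ofPred_forall]
    refine (isOpen_iInter_of_finite fun j => ?_).inter
      (isOpen_lt (Complex.continuous_re.comp hcA).abs continuous_const)
    exact (isOpen_lt continuous_const (Complex.continuous_im.comp (hc j))).inter
      (isOpen_lt (Complex.continuous_re.comp (hc j)).abs continuous_const)
  · have hUdef : (Set.univ : Set ℝ).Definable ranExp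
        {v : ((α ⊕ β) ⊕ Unit) ⊕ ((α ⊕ β) ⊕ Unit) → ℝ | ofRealCoords v ∈ U} := by
      have habs : ∀ {m : (α → ℂ) × (β → ℂ) → ℂ}, IsRealAffine m →
          (Set.univ : Set ℝ).Definable ranExp
          {v : ((α ⊕ β) ⊕ Unit) ⊕ ((α ⊕ β) ⊕ Unit) → ℝ | |(m (ofRealCoords v)).re| < R} := by
        intro m hm
        simp only [abs_lt]
        exact ((IsTermFun.const _).definable_lt hm.isTermFun_re).inter
          (hm.isTermFun_re.definable_lt (IsTermFun.const _))
      have hU' : {v : ((α ⊕ β) ⊕ Unit) ⊕ ((α ⊕ β) ⊕ Unit) → ℝ | ofRealCoords v ∈ U} =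
          (⋂ j, ({v | - lam j < (l j (ofRealCoords v)).im} ∩
            {v | |(l j (ofRealCoords v)).re| < R})) ∩ {v | |(A (ofRealCoords v)).re| < R} := by
        ext v
        simp [hU]
      rw [hU']
      exact (Set.definable_iInter_of_finite fun j =>
        ((IsTermFun.const _).definable_lt (hl j).isTermFun_im).inter (habs (hl j))).inter (habs hA)
    have hpre : IsTermFun fun v : ((α ⊕ β) ⊕ Unit) ⊕ ((α ⊕ β) ⊕ Unit) → ℝ =>
        Real.exp (- (Real.pi * (A (ofRealCoords v)).im)) :=
      ((IsTermFun.const _).mul hA.isTermFun_im).neg.exp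
    -- The truncation to the cube is invisible over `U`, by `hmem`.
    have hE : realGraphOn f U = {v | ofRealCoords v ∈ U} ∩
        ({v | v (.inl (.inr ())) = Real.exp (- (Real.pi * (A (ofRealCoords v)).im)) *
            Set.indicator (Set.Icc (-1) 1) (fun u => (G u).re) fun i => arg i (ofRealCoords v)} ∩
          {v | v (.inr (.inr ())) = Real.exp (- (Real.pi * (A (ofRealCoords v)).im)) *
            Set.indicator (Set.Icc (-1) 1) (fun u => (G u).im)
              fun i => arg i (ofRealCoords v)}) := by
      rw [realGraphOn_eq]
      ext v
      refine and_congr_right fun hv => ?_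
      simp only [Set.mem_ofPred_eq, Set.mem_inter_iff]
      rw [hval _ hv, Complex.re_ofReal_mul, Complex.im_ofReal_mul,
        Set.indicator_of_mem (hmem _ hv), Set.indicator_of_mem (hmem _ hv)]
    rw [DefinableOn, hE]
    exact hUdef.inter (((IsTermFun.coord _).definable_eq
      (hpre.mul (IsTermFun.restricted hre harg))).inter ((IsTermFun.coord _).definable_eq
      (hpre.mul (IsTermFun.restricted him harg))))

theorem DefinableOn.iUnion {α β κ : Type*} [Finite κ] {f : (α → ℂ) → (β → ℂ) → ℂ}
    {U : κ → Set ((α → ℂ) × (β → ℂ))} (h : ∀ i, DefinableOn f (U i)) :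
    DefinableOn f (⋃ i, U i) := by
  have : realGraphOn f (⋃ i, U i) = ⋃ i, realGraphOn f (U i) := by
    ext v
    simp only [realGraphOn, Set.mem_iUnion, Set.mem_ofPred_eq]
    constructor
    · rintro ⟨p, ⟨i, hi⟩, rfl⟩
      exact ⟨i, p, hi, rfl⟩
    · rintro ⟨i, p, hi, rfl⟩
      exact ⟨p, ⟨i, hi⟩, rfl⟩
  rw [DefinableOn, this]
  exact Set.definable_iUnion_of_finite h

/-! ### Simultaneous Diophantine approximation -/

/-- Dirichlet's pigeonhole argument: two of the `Q ^ g + 1` multiples `n x` have fractional parts in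
the same box of side `1 / Q`. -/
theorem exists_nat_simultaneous_approx {g : ℕ} (x : Fin g → ℝ) {Q : ℕ} (hQ : 0 < Q) :
    ∃ (q : ℕ) (a : Fin g → ℤ), 0 < q ∧ q ≤ Q ^ g ∧ ∀ i, |q * x i - a i| ≤ 1 / Q := by
  have hQ' : (0 : ℝ) < Q := by exact_mod_cast hQ
  let box : ℕ → Fin g → Fin Q := fun n i => ⟨⌊Q * Int.fract (n * x i)⌋₊, by
    rw [Nat.floor_lt (mul_nonneg hQ'.le (Int.fract_nonneg _))]
    exact mul_lt_of_lt_one_right hQ' (Int.fract_lt_one _)⟩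
  have key : ∀ m n : ℕ, m < n → n ≤ Q ^ g → box m = box n →
      ∃ (q : ℕ) (a : Fin g → ℤ), 0 < q ∧ q ≤ Q ^ g ∧ ∀ i, |q * x i - a i| ≤ 1 / Q := by
    intro m n hmn hn h
    refine ⟨n - m, fun i => ⌊n * x i⌋ - ⌊m * x i⌋, by omega, by omega, fun i => ?_⟩
    have h1 : ⌊Q * Int.fract (m * x i)⌋₊ = ⌊Q * Int.fract (n * x i)⌋₊ :=
      congrArg Fin.val (congrFun h i)
    have e : ((n - m : ℕ) : ℝ) * x i - ((⌊n * x i⌋ - ⌊m * x i⌋ : ℤ) : ℝ) =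
        Int.fract (n * x i) - Int.fract (m * x i) := by
      rw [Nat.cast_sub hmn.le, Int.fract, Int.fract]
      push_cast
      ring
    have a1 := Nat.floor_le (mul_nonneg hQ'.le (Int.fract_nonneg (m * x i)))
    have a2 := Nat.lt_floor_add_one (Q * Int.fract (m * x i))
    have a3 := Nat.floor_le (mul_nonneg hQ'.le (Int.fract_nonneg (n * x i)))
    have a4 := Nat.lt_floor_add_one (Q * Int.fract (n * x i))
    rw [h1] at a1 a2
    have h2 : |Q * (Int.fract (n * x i) - Int.fract (m * x i))| ≤ 1 :=
      abs_le.2 ⟨by linarith, by linarith⟩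
    rw [abs_mul, abs_of_pos hQ'] at h2
    rw [e, le_div_iff₀ hQ', mul_comm]
    exact h2
  obtain ⟨m, hm, n, hn, hmn, h⟩ := Finset.exists_ne_map_eq_of_card_lt_of_maps_to
    (s := Finset.range (Q ^ g + 1)) (t := Finset.univ) (f := box) (by simp)
    (fun _ _ => Finset.mem_univ _)
  rw [Finset.mem_range] at hm hn
  rcases lt_or_gt_of_ne hmn with h' | h'
  · exact key m n h' (by omega) h
  · exact key n m h' (by omega) h.symm

/-! ### Quadratic forms -/

theorem quadForm_eq_sum {R : Type*} [CommRing R] {g : ℕ} (M : Matrix (Fin g) (Fin g) R)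
    (x : Fin g → R) : quadForm M x = ∑ i, ∑ j, x i * M i j * x j := by
  simp only [quadForm, dotProduct, Matrix.mulVec, Finset.mul_sum, mul_assoc]

theorem quadForm_smul {R : Type*} [CommRing R] {g : ℕ} (M : Matrix (Fin g) (Fin g) R) (c : R)
    (x : Fin g → R) : quadForm M (c • x) = c ^ 2 * quadForm M x := by
  simp only [quadForm_eq_sum, Finset.mul_sum, Pi.smul_apply, smul_eq_mul]
  exact Finset.sum_congr rfl fun i _ => Finset.sum_congr rfl fun j _ => by ring

theorem quadForm_single {R : Type*} [CommRing R] {g : ℕ} (M : Matrix (Fin g) (Fin g) R)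
    (i : Fin g) (c : R) : quadForm M (Pi.single i c) = c ^ 2 * M i i := by
  simp [quadForm]
  ring

section

variable {g : ℕ} {M : Matrix (Fin g) (Fin g) ℝ}

theorem quadForm_add_le (hM : ∀ x, 0 ≤ quadForm M x) (u v : Fin g → ℝ) :
    quadForm M (u + v) ≤ 2 * (quadForm M u + quadForm M v) := by
  have h := hM (u - v)
  simp only [quadForm, Matrix.mulVec_add, Matrix.mulVec_sub, dotProduct_add, dotProduct_sub,
    add_dotProduct, sub_dotProduct] at h ⊢
  linarith

theorem quadForm_add_add_le (hM : ∀ x, 0 ≤ quadForm M x) (u v w : Fin g → ℝ) :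
    quadForm M (u + v + w) ≤ 3 * (quadForm M u + quadForm M v + quadForm M w) := by
  have h1 := hM (u - v)
  have h2 := hM (u - w)
  have h3 := hM (v - w)
  simp only [quadForm, Matrix.mulVec_add, Matrix.mulVec_sub, dotProduct_add, dotProduct_sub,
    add_dotProduct, sub_dotProduct] at h1 h2 h3 ⊢
  linarith

theorem quadForm_le_of_entries_le {x : Fin g → ℝ} {K : ℝ}
    (h : ∀ i j, |x i| * |M i j| * |x j| ≤ K) : quadForm M x ≤ (g : ℝ) ^ 2 * K := by
  rw [quadForm_eq_sum]
  calc ∑ i, ∑ j, x i * M i j * x j ≤ ∑ _i : Fin g, ∑ _j : Fin g, K :=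
        Finset.sum_le_sum fun i _ => Finset.sum_le_sum fun j _ =>
          (le_abs_self _).trans (by rw [abs_mul, abs_mul]; exact h i j)
    _ = (g : ℝ) ^ 2 * K := by simp; ring

/-- The properties of Minkowski reduced matrices from which the lower bound is derived. -/
structure IsReduced (M : Matrix (Fin g) (Fin g) ℝ) : Prop where
  symm : ∀ i j, M i j = M j i
  pos : ∀ i, 0 < M i i
  mono : Monotone fun i => M i i
  abs_le : ∀ i j, |M i j| ≤ M i i
  nonneg : ∀ x, 0 ≤ quadForm M x
  le : ∀ (k : Fin g) (a : Fin g → ℤ), (Finset.Ici k).gcd a = 1 →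
    M k k ≤ quadForm M fun i => (a i : ℝ)

/-- Descend from `k`: as long as some earlier `γ i` exceeds `κ` times the current value, move to it,
losing a factor `κ` at each step. -/
theorem exists_index_gap {γ : Fin g → ℝ} (hγ : ∀ i, 0 < γ i) {κ : ℝ} (h0 : 0 < κ) (h1 : κ ≤ 1)
    (k : Fin g) : ∃ j ≤ k, κ ^ (k : ℕ) * γ k ≤ γ j ∧ ∀ i < j, γ i ≤ κ * γ j := by
  induction h : (k : ℕ) using Nat.strong_induction_on generalizing k with
  | _ n ih =>
    subst h
    by_cases hk : ∀ i < k, γ i ≤ κ * γ k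
    · exact ⟨k, le_rfl, mul_le_of_le_one_left (hγ k).le (pow_le_one₀ h0.le h1), hk⟩
    · push Not at hk
      obtain ⟨i, hik, hi⟩ := hk
      obtain ⟨j, hji, hj, hj'⟩ := ih i hik i rfl
      refine ⟨j, hji.trans hik.le, ?_, hj'⟩
      refine le_trans ?_ hj
      calc κ ^ (k : ℕ) * γ k ≤ κ ^ ((i : ℕ) + 1) * γ k :=
            mul_le_mul_of_nonneg_right (pow_le_pow_of_le_one h0.le h1 hik) (hγ k).le
        _ = κ ^ (i : ℕ) * (κ * γ k) := by ring
        _ ≤ κ ^ (i : ℕ) * γ i := mul_le_mul_of_nonneg_left hi.le (pow_nonneg h0.le _)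

/-- Approximate a multiple `t x` by an integral vector `A` that is primitive from the gap index `j`
on. Reduction gives `M j j ≤ M[A]`. The error below `j` costs little because the diagonal entries
there are tiny compared with `M j j`; the error from `j` on costs little because the approximation
is good. Hence `M j j`, and with it `M k k`, is bounded by a multiple of `M[x]`. -/
theorem exists_lower_bound_last (g : ℕ) : ∃ c : ℝ, 0 < c ∧ ∀ M : Matrix (Fin g) (Fin g) ℝ,
    IsReduced M → ∀ (k : Fin g) (x : Fin g → ℝ), x k = 1 → (∀ i, k < i → x i = 0) →
      c * M k k ≤ quadForm M x := by
  -- Both `κ` and `Q` are chosen so that each of the two error terms, multiplied by `3`, is at most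
  -- `M j j / 3`.
  set κ : ℝ := 1 / (9 * ((g : ℝ) + 1) ^ 2) with hκ
  have hg : (0 : ℝ) ≤ g := g.cast_nonneg
  have hκ0 : 0 < κ := by positivity
  have hκ1 : κ ≤ 1 := by
    rw [hκ, div_le_one (by positivity)]
    nlinarith
  have hgκ : 9 * (g : ℝ) ^ 2 * κ ≤ 1 := by
    rw [hκ, mul_one_div, div_le_one (by positivity)]
    nlinarith
  -- The summand `2` gives `1 / Q ≤ 1 / 2`, which forces `a k = q` and `a i = 0` for `i > k`
  -- exactly.
  obtain ⟨Q, hQ⟩ := exists_nat_ge (9 * (g : ℝ) ^ 2 / κ ^ g + 2)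
  have hQ2 : (2 : ℝ) ≤ Q := le_trans (by have : 0 ≤ 9 * (g : ℝ) ^ 2 / κ ^ g := by positivity
                                         linarith) hQ
  have hQ0 : (0 : ℝ) < Q := by linarith
  have hQκ : 9 * (g : ℝ) ^ 2 / (Q : ℝ) ^ 2 ≤ κ ^ g := by
    rw [div_le_iff₀ (by positivity), ← div_le_iff₀' (by positivity)]
    nlinarith
  refine ⟨κ ^ g / (9 * ((Q : ℝ) ^ g) ^ 2), by positivity, fun M hM k x hxk hx => ?_⟩
  obtain ⟨j, hjk, hj, hj'⟩ := exists_index_gap hM.pos hκ0 hκ1 k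
  replace hj : κ ^ g * M k k ≤ M j j := le_trans (mul_le_mul_of_nonneg_right
    (pow_le_pow_of_le_one hκ0.le hκ1 k.2.le) (hM.pos k).le) hj
  obtain ⟨q, a, hq0, hqQ, hqa⟩ := exists_nat_simultaneous_approx x (Q := Q)
    (by exact_mod_cast hQ0)
  have hQinv : (1 : ℝ) / Q ≤ 1 / 2 := one_div_le_one_div_of_le two_pos hQ2
  have hak : a k = q := by
    have h := (hqa k).trans hQinv
    rw [hxk, mul_one] at h
    have h' : |(q : ℤ) - a k| < 1 := by
      have : |((q : ℤ) - a k : ℤ)| < (1 : ℝ) := by push_cast; linarith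
      exact_mod_cast this
    have := Int.abs_lt_one_iff.1 h'
    omega
  have hai : ∀ i, k < i → a i = 0 := fun i hi => by
    have h := (hqa i).trans hQinv
    rw [hx i hi, mul_zero, zero_sub, abs_neg] at h
    have h' : |a i| < 1 := by
      have : |(a i : ℝ)| < 1 := by linarith
      exact_mod_cast this
    exact Int.abs_lt_one_iff.1 h'
  -- Dividing by the gcd `e` makes the tail primitive and only improves the approximation, with `t =
  -- q / e` in place of `q`.
  obtain ⟨a', ha', hgcd⟩ := (Finset.Ici j).extract_gcd a ⟨j, Finset.mem_Ici.2 le_rfl⟩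
  set e := (Finset.Ici j).gcd a
  have hek : (q : ℤ) = e * a' k := by rw [← hak]; exact ha' k (Finset.mem_Ici.2 hjk)
  have he0 : e ≠ 0 := fun h => by rw [h, zero_mul] at hek; omega
  have he1 : (1 : ℝ) ≤ |(e : ℝ)| := by exact_mod_cast Int.one_le_abs he0
  set t : ℝ := (a' k : ℝ) with ht
  have hqt : (q : ℝ) = e * t := by rw [ht]; exact_mod_cast hek
  have htQ : t ^ 2 ≤ ((Q : ℝ) ^ g) ^ 2 := by
    rw [sq_le_sq, abs_of_nonneg (by positivity : (0 : ℝ) ≤ (Q : ℝ) ^ g)]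
    have h1 : (q : ℝ) ≤ (Q : ℝ) ^ g := by exact_mod_cast hqQ
    have h2 : |(q : ℝ)| = |(e : ℝ)| * |t| := by rw [hqt, abs_mul]
    rw [abs_of_nonneg (Nat.cast_nonneg q)] at h2
    nlinarith [abs_nonneg t]
  have happ : ∀ i, j ≤ i → |(a' i : ℝ) - t * x i| ≤ 1 / Q := fun i hi => by
    have h1 : (a i : ℝ) = e * a' i := by exact_mod_cast ha' i (Finset.mem_Ici.2 hi)
    have h2 : (q : ℝ) * x i - a i = - (e * ((a' i : ℝ) - t * x i)) := by rw [hqt, h1]; ring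
    have h3 := hqa i
    rw [h2, abs_neg, abs_mul] at h3
    nlinarith [abs_nonneg ((a' i : ℝ) - t * x i)]
  have ha'0 : ∀ i, k < i → a' i = 0 := fun i hi => by
    have h1 := ha' i (Finset.mem_Ici.2 (hjk.trans hi.le))
    rw [hai i hi] at h1
    exact (mul_eq_zero.1 h1.symm).resolve_left he0
  -- Below `j` any integers are allowed by the gcd condition, so rounding is enough there.
  let A : Fin g → ℤ := fun i => if j ≤ i then a' i else round (t * x i)
  have hA : (Finset.Ici j).gcd A = 1 := by
    rw [← hgcd]
    exact Finset.gcd_congr rfl fun i hi => by simp [A, Finset.mem_Ici.1 hi]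
  let v : Fin g → ℝ := fun i => if j ≤ i then 0 else round (t * x i) - t * x i
  let w : Fin g → ℝ := fun i => if j ≤ i then a' i - t * x i else 0
  have hsum : (fun i => (A i : ℝ)) = t • x + v + w := by
    funext i
    by_cases hi : j ≤ i <;> simp [A, v, w, hi]
  have h1 := hM.le j A hA
  rw [hsum] at h1
  have h2 := h1.trans (quadForm_add_add_le hM.nonneg _ _ _)
  rw [quadForm_smul] at h2
  have hv : quadForm M v ≤ (g : ℝ) ^ 2 * (κ * M j j) := by
    refine quadForm_le_of_entries_le fun i l => ?_
    by_cases hi : j ≤ i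
    · simp only [v, if_pos hi, abs_zero, zero_mul]
      exact mul_nonneg hκ0.le (hM.pos j).le
    · have hMj := (hM.pos j).le
      have hv1 : ∀ i, |v i| ≤ 1 := fun i => by
        by_cases hi : j ≤ i
        · simp [v, hi]
        · simp only [v, if_neg hi]
          rw [abs_sub_comm]
          exact (abs_sub_round _).trans (by norm_num)
      have hMi : |M i l| ≤ κ * M j j := (hM.abs_le i l).trans (hj' i (not_le.1 hi))
      calc |v i| * |M i l| * |v l| ≤ 1 * (κ * M j j) * 1 := by
            gcongr
            · exact hv1 i
            · exact hv1 l
        _ = κ * M j j := by ring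
  have hw : quadForm M w ≤ (g : ℝ) ^ 2 * (1 / Q * M k k * (1 / Q)) := by
    have hMk := (hM.pos k).le
    refine quadForm_le_of_entries_le fun i l => ?_
    by_cases hi : k < i
    · have : w i = 0 := by simp [w, ha'0 i hi, hx i hi]
      rw [this, abs_zero, zero_mul, zero_mul]
      positivity
    · have hw1 : ∀ i, |w i| ≤ 1 / Q := fun i => by
        by_cases hi : j ≤ i
        · simpa only [w, if_pos hi] using happ i hi
        · simp [w, hi]
      have hMi : |M i l| ≤ M k k := (hM.abs_le i l).trans (hM.mono (not_lt.1 hi))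
      gcongr
      · exact hw1 i
      · exact hw1 l
  have hx0 := hM.nonneg x
  have hb1 : 3 * ((g : ℝ) ^ 2 * (κ * M j j)) ≤ M j j / 3 := by
    nlinarith [mul_le_mul_of_nonneg_right hgκ (hM.pos j).le]
  have hb2 : 3 * ((g : ℝ) ^ 2 * (1 / Q * M k k * (1 / Q))) ≤ M j j / 3 := by
    have := (mul_le_mul_of_nonneg_right hQκ (hM.pos k).le).trans hj
    have e : 3 * ((g : ℝ) ^ 2 * (1 / Q * M k k * (1 / Q))) =
      (9 * (g : ℝ) ^ 2 / (Q : ℝ) ^ 2 * M k k) / 3 := by field_simp; ring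
    rw [e]
    linarith
  have hb3 : t ^ 2 * quadForm M x ≤ ((Q : ℝ) ^ g) ^ 2 * quadForm M x :=
    mul_le_mul_of_nonneg_right htQ hx0
  have hfin : M j j ≤ 9 * ((Q : ℝ) ^ g) ^ 2 * quadForm M x := by linarith
  rw [div_mul_eq_mul_div, div_le_iff₀ (by positivity)]
  linarith

/-- Strip off the last nonzero coordinate: its contribution is controlled by the homogeneous form of
`exists_lower_bound_last`, and removing it changes the value of the form by a bounded factor. -/
theorem exists_lower_bound (g : ℕ) : ∃ c : ℝ, 0 < c ∧ ∀ M : Matrix (Fin g) (Fin g) ℝ,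
    IsReduced M → ∀ x : Fin g → ℝ, c * ∑ i, x i ^ 2 * M i i ≤ quadForm M x := by
  obtain ⟨c₀, hc₀, h₀⟩ := exists_lower_bound_last g
  have hlast : ∀ M : Matrix (Fin g) (Fin g) ℝ, IsReduced M → ∀ (k : Fin g) (x : Fin g → ℝ),
      (∀ i, k < i → x i = 0) → c₀ * (x k ^ 2 * M k k) ≤ quadForm M x := by
    intro M hM k x hx
    by_cases hk : x k = 0
    · rw [hk]
      simpa using hM.nonneg x
    · have h := h₀ M hM k ((x k)⁻¹ • x) (by simp [hk]) fun i hi => by simp [hx i hi]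
      rw [quadForm_smul] at h
      have h2 := mul_le_mul_of_nonneg_left h (sq_nonneg (x k))
      have e : x k ^ 2 * ((x k)⁻¹ ^ 2 * quadForm M x) = quadForm M x := by field_simp
      rw [e] at h2
      linarith
  have key : ∀ n : ℕ, ∃ c : ℝ, 0 < c ∧ ∀ M : Matrix (Fin g) (Fin g) ℝ, IsReduced M →
      ∀ x : Fin g → ℝ, (∀ i : Fin g, n ≤ i → x i = 0) →
        c * ∑ i, x i ^ 2 * M i i ≤ quadForm M x := by
    intro n
    induction n with
    | zero =>
      refine ⟨1, one_pos, fun M hM x hx => ?_⟩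
      have : x = 0 := funext fun i => hx i (Nat.zero_le _)
      simp [this, quadForm]
    | succ n ih =>
      obtain ⟨c, hc, h⟩ := ih
      by_cases hn : n < g
      · set k : Fin g := ⟨n, hn⟩
        -- Each of the two contributions is to be at most half of `M[x]`; the second uses `c * S ≤
        -- M[y] ≤ 2 * (1 + 1 / c₀) * M[x]`.
        refine ⟨min (c₀ / 2) (c / (4 * (1 + 1 / c₀))), by positivity, fun M hM x hx => ?_⟩
        have h1 := hlast M hM k x fun i hi => hx i hi
        set y : Fin g → ℝ := x + Pi.single k (- x k) with hy
        have hyk : y k = 0 := by simp [hy]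
        have hyi : ∀ i, i ≠ k → y i = x i := fun i hi => by simp [hy, hi]
        have h2 := h M hM y fun i hi => by
          by_cases hik : i = k
          · rw [hik, hyk]
          · rw [hyi i hik]
            refine hx i ?_
            have : (i : ℕ) ≠ n := fun e => hik (Fin.ext e)
            omega
        have h3 := quadForm_add_le hM.nonneg x (Pi.single k (- x k))
        rw [← hy, quadForm_single, neg_sq] at h3
        have hsum : ∑ i, x i ^ 2 * M i i = x k ^ 2 * M k k + ∑ i, y i ^ 2 * M i i := by
          rw [← Finset.add_sum_erase _ _ (Finset.mem_univ k),
            ← Finset.add_sum_erase _ (fun i => y i ^ 2 * M i i) (Finset.mem_univ k), hyk]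
          rw [Finset.sum_congr rfl fun i hi => by rw [← hyi i (Finset.ne_of_mem_erase hi)]]
          ring
        set S := ∑ i, y i ^ 2 * M i i
        have hS : 0 ≤ S := Finset.sum_nonneg fun i _ => mul_nonneg (sq_nonneg _) (hM.pos i).le
        have hxk : 0 ≤ x k ^ 2 * M k k := mul_nonneg (sq_nonneg _) (hM.pos k).le
        have hx0 := hM.nonneg x
        rw [hsum]
        have h4 : x k ^ 2 * M k k ≤ 1 / c₀ * quadForm M x := by
          rw [one_div, ← div_eq_inv_mul, le_div_iff₀ hc₀]
          linarith
        have h5 : c / (4 * (1 + 1 / c₀)) * S ≤ quadForm M x / 2 := by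
          rw [div_mul_eq_mul_div, div_le_iff₀ (by positivity)]
          linarith
        have h6 := mul_le_mul_of_nonneg_right (min_le_right (c₀ / 2) (c / (4 * (1 + 1 / c₀)))) hS
        have h7 := mul_le_mul_of_nonneg_right (min_le_left (c₀ / 2) (c / (4 * (1 + 1 / c₀)))) hxk
        linarith
      · exact ⟨c, hc, fun M hM x hx => h M hM x fun i hi => absurd i.2 (by omega)⟩
  obtain ⟨c, hc, h⟩ := key g
  exact ⟨c, hc, fun M hM x => h M hM x fun i hi => absurd i.2 (by omega)⟩

end

/-! ### Minkowski reduced matrices -/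

/-- By homogeneity the form is nonnegative at rational points, and these are dense. -/
theorem quadForm_nonneg_of_int {g : ℕ} {M : Matrix (Fin g) (Fin g) ℝ}
    (h : ∀ a : Fin g → ℤ, 0 ≤ quadForm M fun i => (a i : ℝ)) (x : Fin g → ℝ) :
    0 ≤ quadForm M x := by
  have hlim : Filter.Tendsto (fun (n : ℕ) (i : Fin g) => ((n : ℝ) + 1)⁻¹ * ⌊((n : ℝ) + 1) * x i⌋)
      Filter.atTop (nhds x) := by
    refine tendsto_pi_nhds.2 fun i => ?_
    refine tendsto_of_tendsto_of_tendsto_of_le_of_le (g := fun n : ℕ => x i - ((n : ℝ) + 1)⁻¹)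
      (h := fun _ => x i) ?_ tendsto_const_nhds (fun n => ?_) (fun n => ?_)
    · have := (tendsto_const_nhds (x := x i)).sub (tendsto_one_div_add_atTop_nhds_zero_nat (𝕜 := ℝ))
      simpa using this
    · have hn : (0 : ℝ) < n + 1 := by positivity
      have := Int.lt_floor_add_one (((n : ℝ) + 1) * x i)
      dsimp only
      rw [← mul_le_mul_iff_right₀ hn, ← mul_assoc, mul_inv_cancel₀ hn.ne', one_mul, mul_sub,
        mul_inv_cancel₀ hn.ne']
      linarith
    · have hn : (0 : ℝ) < n + 1 := by positivity
      have := Int.floor_le (((n : ℝ) + 1) * x i)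
      dsimp only
      rwa [inv_mul_le_iff₀ hn]
  have hcont : Continuous fun x : Fin g → ℝ => quadForm M x := by
    simp only [quadForm_eq_sum]
    fun_prop
  refine ge_of_tendsto' ((hcont.tendsto x).comp hlim) fun n => ?_
  have := quadForm_smul M ((n : ℝ) + 1)⁻¹ fun i => ((⌊((n : ℝ) + 1) * x i⌋ : ℤ) : ℝ)
  simp only [Function.comp_apply]
  refine le_of_le_of_eq (mul_nonneg (sq_nonneg _) (h _)) this.symm

/-- Testing the Minkowski inequalities on `e j` gives monotonicity of the diagonal, and on `e j ± e
i` the bound of the off-diagonal entries. Primitive vectors, tested against the first diagonal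
entry, give nonnegativity on integral vectors. -/
theorem isReduced_of_mem_minkowskiCone {g : ℕ} [NeZero g] {b : Sym2 (Fin g) → ℝ}
    (hb : b ∈ minkowskiCone g) (h0 : 0 < symMatrix b 0 0) : IsReduced (symMatrix b) := by
  obtain ⟨-, hle, -⟩ := hb
  have hsymm : ∀ i j, symMatrix b i j = symMatrix b j i := fun i j => by
    simp [symMatrix, Sym2.eq_swap]
  have hpair : ∀ (i j : Fin g) (s : ℝ), quadForm (symMatrix b) (Pi.single j 1 + Pi.single i s) =
      symMatrix b j j + 2 * s * symMatrix b i j + s ^ 2 * symMatrix b i i := fun i j s => by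
    simp only [quadForm, Matrix.mulVec_add, dotProduct_add, add_dotProduct,
      Matrix.mulVec_single, single_dotProduct]
    simp [hsymm j i]
    ring
  have hmono : Monotone fun i => symMatrix b i i := by
    intro i j hij
    have hgcd : (Finset.Ici i).gcd (Pi.single j 1 : Fin g → ℤ) = 1 := by
      have := Finset.gcd_dvd (f := (Pi.single j 1 : Fin g → ℤ)) (Finset.mem_Ici.2 hij)
      rw [Pi.single_eq_same] at this
      rw [← Finset.normalize_gcd]
      exact normalize_eq_one.2 (isUnit_of_dvd_one this)
    have h := hle i _ hgcd
    have e : (fun l => ((Pi.single j 1 : Fin g → ℤ) l : ℝ)) = Pi.single j 1 := by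
      funext l
      by_cases hl : l = j
      · subst hl; simp
      · simp [hl]
    rw [e, quadForm_single] at h
    simpa using h
  have hpos : ∀ i, 0 < symMatrix b i i := fun i => h0.trans_le (hmono (Fin.zero_le i))
  have hlt : ∀ i j, i < j → |symMatrix b i j| ≤ symMatrix b i i := by
    intro i j hij
    have key : ∀ s : ℤ, s ^ 2 = 1 → 0 ≤ 2 * s * symMatrix b i j + symMatrix b i i := by
      intro s hs
      have hgcd : (Finset.Ici j).gcd (Pi.single j 1 + Pi.single i s : Fin g → ℤ) = 1 := by
        have := Finset.gcd_dvd (f := (Pi.single j 1 + Pi.single i s : Fin g → ℤ))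
          (Finset.mem_Ici.2 (le_refl j))
        rw [Pi.add_apply, Pi.single_eq_same, Pi.single_eq_of_ne hij.ne', add_zero] at this
        rw [← Finset.normalize_gcd]
        exact normalize_eq_one.2 (isUnit_of_dvd_one this)
      have h := hle j _ hgcd
      have e : (fun l => ((Pi.single j 1 + Pi.single i s : Fin g → ℤ) l : ℝ)) =
          Pi.single j 1 + Pi.single i (s : ℝ) := by
        funext l
        simp only [Pi.add_apply, Int.cast_add, Pi.single_apply]
        split_ifs <;> simp
      have hs' : (s : ℝ) ^ 2 = 1 := by exact_mod_cast hs
      rw [e, hpair, hs'] at h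
      linarith
    have h1 := key 1 (by norm_num)
    have h2 := key (-1) (by norm_num)
    push_cast at h1 h2
    have := hpos i
    exact abs_le.2 ⟨by linarith, by linarith⟩
  refine ⟨hsymm, hpos, hmono, fun i j => ?_, quadForm_nonneg_of_int fun a => ?_, hle⟩
  · rcases lt_trichotomy i j with h | h | h
    · exact hlt i j h
    · subst h
      exact (abs_of_pos (hpos i)).le
    · rw [hsymm]
      exact (hlt j i h).trans (hmono h.le)
  · obtain ⟨a', ha', hgcd⟩ := (Finset.univ : Finset (Fin g)).extract_gcd a Finset.univ_nonempty
    have hIci : Finset.Ici (0 : Fin g) = Finset.univ := by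
      ext i
      simp
    have h := h0.le.trans (hle 0 a' (hIci ▸ hgcd))
    have e : (fun i => (a i : ℝ)) = (((Finset.univ.gcd a : ℤ) : ℝ)) • fun i => (a' i : ℝ) := by
      funext i
      rw [ha' i (Finset.mem_univ i)]
      simp
    rw [e, quadForm_smul]
    exact mul_nonneg (sq_nonneg _) h

/-! ### Nearly orthogonal bases -/

/-- Unipotent upper triangular matrices with an integral multiple of the inverse. -/
structure IsRatUnipotent {g : ℕ} (P : Matrix (Fin g) (Fin g) ℝ) : Prop where
  diag : ∀ i, P i i = 1
  lower : ∀ i j, j < i → P i j = 0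
  exists_inverse : ∃ (N : ℤ) (A : Matrix (Fin g) (Fin g) ℤ), N ≠ 0 ∧
    A.map (Int.cast : ℤ → ℝ) * P = (N : ℝ) • (1 : Matrix (Fin g) (Fin g) ℝ)

/-- The composition of a shear along the first basis vector and a transformation of the others. -/
def extendUnipotent {g : ℕ} (w : Fin g → ℝ) (P : Matrix (Fin g) (Fin g) ℝ) :
    Matrix (Fin (g + 1)) (Fin (g + 1)) ℝ :=
  Matrix.of fun i j => Fin.cases (Fin.cases 1 (fun j => - ∑ l, w l * P l j) j)
    (fun k => Fin.cases 0 (fun j => P k j) j) i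

section

variable {g : ℕ} (w : Fin g → ℝ) (P : Matrix (Fin g) (Fin g) ℝ)

@[simp] theorem extendUnipotent_zero_zero : extendUnipotent w P 0 0 = 1 := rfl

@[simp] theorem extendUnipotent_zero_succ (j : Fin g) :
    extendUnipotent w P 0 j.succ = - ∑ l, w l * P l j := rfl

@[simp] theorem extendUnipotent_succ_zero (i : Fin g) : extendUnipotent w P i.succ 0 = 0 := rfl

@[simp] theorem extendUnipotent_succ_succ (i j : Fin g) :
    extendUnipotent w P i.succ j.succ = P i j := rfl

variable {w P}

/-- The inverse has first row `(1, w / N)` and lower block `P⁻¹`, so `N * N'` clears its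
denominators. -/
theorem IsRatUnipotent.extend (hP : IsRatUnipotent P) {N : ℤ} (hN : N ≠ 0) (w : Fin g → ℤ) :
    IsRatUnipotent (extendUnipotent (fun l => (w l : ℝ) / N) P) := by
  obtain ⟨N', A, hN', hA⟩ := hP.exists_inverse
  have hN0 : (N : ℝ) ≠ 0 := by exact_mod_cast hN
  refine ⟨fun i => ?_, fun i j hij => ?_, N * N', Matrix.of fun i j => Fin.cases
    (Fin.cases (N * N') (fun l => N' * w l) j) (fun k => Fin.cases 0 (fun j => N * A k j) j) i,
    mul_ne_zero hN hN', ?_⟩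
  · refine Fin.cases ?_ (fun i => ?_) i
    · rfl
    · simpa using hP.diag i
  · revert hij
    refine Fin.cases ?_ (fun i => ?_) i
    · intro h
      exact absurd h (Fin.not_lt_zero j)
    · refine Fin.cases ?_ (fun j => ?_) j
      · intro _
        rfl
      · intro h
        exact hP.lower i j (Fin.succ_lt_succ_iff.1 h)
  · ext i j
    rw [Matrix.mul_apply, Fin.sum_univ_succ]
    refine Fin.cases ?_ (fun i => ?_) i <;> refine Fin.cases ?_ (fun j => ?_) j
    · simp
    · simp only [Matrix.map_apply, Matrix.of_apply, Fin.cases_zero, Fin.cases_succ,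
        extendUnipotent_zero_succ, extendUnipotent_succ_succ, Matrix.smul_apply,
        Matrix.one_apply_ne (Fin.succ_ne_zero j).symm, smul_zero]
      rw [mul_neg, Finset.mul_sum, neg_add_eq_zero]
      refine Finset.sum_congr rfl fun l _ => ?_
      push_cast
      field_simp
    · simp [Matrix.one_apply_ne (Fin.succ_ne_zero i)]
    · have h := congrFun (congrFun hA i) j
      rw [Matrix.mul_apply] at h
      simp only [Matrix.map_apply, Matrix.of_apply, Fin.cases_zero, Fin.cases_succ,
        extendUnipotent_zero_succ, extendUnipotent_succ_succ, Matrix.smul_apply, Int.cast_zero,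
        zero_mul, zero_add] at h ⊢
      push_cast
      simp only [mul_assoc, ← Finset.mul_sum, h]
      simp only [Matrix.one_apply, Fin.succ_inj, smul_eq_mul]
      ring

end

/-- Gram–Schmidt with coefficients rounded to multiples of `1 / N`: make the other vectors nearly
orthogonal to `e 0`, then apply induction to them. The lower bound keeps the coefficients bounded,
hence finitely many choices suffice. A general space `V` is needed because the sheared vectors span
a proper subspace. -/
theorem exists_finite_nearly_orthogonal {V : Type*} [AddCommGroup V] [Module ℝ V]
    (g : ℕ) (c C ε : ℝ) (hc : 0 < c) (hε : 0 < ε) :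
    ∃ S : Set (Matrix (Fin g) (Fin g) ℝ), S.Finite ∧ (∀ P ∈ S, IsRatUnipotent P) ∧
      ∀ (B : LinearMap.BilinForm ℝ V) (e : Fin g → V) (γ : Fin g → ℝ), B.IsSymm →
        Monotone γ → (∀ i, 0 < γ i) →
        (∀ x : Fin g → ℝ, c * ∑ i, x i ^ 2 * γ i ≤ B (∑ i, x i • e i) (∑ i, x i • e i)) →
        (∀ i j, i ≤ j → |B (e i) (e j)| ≤ C * γ i) →
        ∃ P ∈ S, ∀ i j, i ≠ j → |B (∑ k, P k i • e k) (∑ k, P k j • e k)| ≤ ε * γ i := by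
  induction g generalizing C with
  | zero =>
    refine ⟨{0}, Set.finite_singleton _, ?_, fun B e γ _ _ _ _ _ => ⟨0, rfl, fun i => i.elim0⟩⟩
    intro P _
    exact ⟨fun i => i.elim0, fun i => i.elim0, 1, 0, one_ne_zero, Subsingleton.elim _ _⟩
  | succ g ih =>
    -- `D` bounds the rounded coefficients: `C / c` for the exact ones and `1` for the rounding. The
    -- absolute value is needed because `C ≥ 0` follows only once `B` is given.
    set D : ℝ := |C| / c + 1 with hD
    have hD0 : 0 < D := by positivity
    obtain ⟨S, hSfin, hSu, hS⟩ := ih (|C| + D * |C| + D * |C| + D * D * |C|)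
    obtain ⟨K, hK0, hK⟩ : ∃ K : ℝ, 0 ≤ K ∧ ∀ P ∈ S, ∀ i j, |P i j| ≤ K := by
      refine ⟨∑ P ∈ hSfin.toFinset, ∑ i, ∑ j, |P i j|, by positivity, fun P hP i j => ?_⟩
      calc |P i j| ≤ ∑ j, |P i j| :=
            Finset.single_le_sum (f := fun j => |P i j|) (fun _ _ => abs_nonneg _)
              (Finset.mem_univ j)
        _ ≤ ∑ i, ∑ j, |P i j| := Finset.single_le_sum (f := fun i => ∑ j, |P i j|)
            (fun _ _ => by positivity) (Finset.mem_univ i)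
        _ ≤ _ := Finset.single_le_sum (f := fun P : Matrix (Fin g) (Fin g) ℝ =>
            ∑ i, ∑ j, |P i j|) (fun _ _ => by positivity) (hSfin.mem_toFinset.2 hP)
    -- The set `S` depends on `D` but not on the mesh, so `N` may be chosen after the bound `K` on
    -- its entries.
    obtain ⟨N, hN⟩ := exists_nat_gt (g * (K * |C|) / ε)
    have hN0 : (0 : ℝ) < N := lt_of_le_of_lt (by positivity) hN
    have hNZ : (N : ℤ) ≠ 0 := by
      have : N ≠ 0 := by rintro rfl; simp at hN0
      exact_mod_cast this
    have hNε : g * (K * (|C| / N)) ≤ ε := by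
      rw [div_lt_iff₀ hε] at hN
      rw [← mul_div_assoc, ← mul_div_assoc, div_le_iff₀ hN0]
      linarith
    obtain ⟨L, hL⟩ := exists_nat_ge (N * D)
    refine ⟨Set.image2 (fun (w : Fin g → ℤ) P =>
      extendUnipotent (fun l => (w l : ℝ) / (N : ℤ)) P) (Set.Icc (fun _ => - (L : ℤ))
      (fun _ => (L : ℤ))) S, (Set.finite_Icc _ _).image2 _ hSfin, ?_, ?_⟩
    · rintro _ ⟨w, _, P, hP, rfl⟩
      exact (hSu P hP).extend hNZ w
    intro B e γ hB hmono hγ hlow hup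
    have hC : |C| = C := by
      refine abs_of_nonneg ?_
      have := (abs_nonneg _).trans (hup 0 0 le_rfl)
      exact nonneg_of_mul_nonneg_left this (hγ 0)
    rw [hC] at hS hNε hD
    have hC0 : 0 ≤ C := hC ▸ abs_nonneg C
    have hB0 : c * γ 0 ≤ B (e 0) (e 0) := by
      have := hlow (Pi.single 0 1)
      simpa [Pi.single_apply] using this
    have hB0pos : 0 < B (e 0) (e 0) := (mul_pos hc (hγ 0)).trans_le hB0
    have hB0le : B (e 0) (e 0) ≤ C * γ 0 := (le_abs_self _).trans (hup 0 0 le_rfl)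
    let w : Fin g → ℤ := fun l => round (N * B (e 0) (e l.succ) / B (e 0) (e 0))
    have hratio : ∀ l : Fin g, |N * B (e 0) (e l.succ) / B (e 0) (e 0)| ≤ N * (C / c) := by
      intro l
      rw [abs_div, abs_mul, abs_of_pos hB0pos, abs_of_pos hN0, div_le_iff₀ hB0pos]
      have h1 := hup 0 l.succ (Fin.zero_le _)
      have h2 : C * γ 0 ≤ C / c * B (e 0) (e 0) := by
        rw [div_mul_eq_mul_div, le_div_iff₀ hc]
        nlinarith
      rw [mul_assoc]
      exact mul_le_mul_of_nonneg_left (h1.trans h2) hN0.le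
    have hN1 : (1 : ℝ) ≤ N := by
      have : 0 < N := by exact_mod_cast hN0
      exact_mod_cast this
    have hw : ∀ l, |(w l : ℝ)| ≤ N * D := by
      intro l
      have h1 := abs_sub_round (N * B (e 0) (e l.succ) / B (e 0) (e 0))
      have h2 : |(w l : ℝ)| ≤ |N * B (e 0) (e l.succ) / B (e 0) (e 0)| + 1 / 2 := by
        have := abs_sub_abs_le_abs_sub (w l : ℝ) (N * B (e 0) (e l.succ) / B (e 0) (e 0))
        rw [abs_sub_comm] at h1
        linarith
      have := hratio l
      rw [hD]
      nlinarith
    set v : Fin g → ℝ := fun l => (w l : ℝ) / (N : ℤ) with hv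
    have hvD : ∀ l, |v l| ≤ D := fun l => by
      simp only [hv, Int.cast_natCast]
      rw [abs_div, abs_of_pos hN0, div_le_iff₀ hN0, mul_comm]
      exact hw l
    let e' : Fin g → V := fun l => e l.succ - v l • e 0
    have hsymm : ∀ x y, B x y = B y x := fun x y => hB.eq x y
    have hcross : ∀ l, |B (e 0) (e' l)| ≤ C * γ 0 / N := by
      intro l
      have h1 := abs_sub_round (N * B (e 0) (e l.succ) / B (e 0) (e 0))
      have e1 : B (e 0) (e' l) = (N * B (e 0) (e l.succ) / B (e 0) (e 0) - w l) *
          (B (e 0) (e 0) / N) := by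
        simp only [e', hv, map_sub, map_smul, smul_eq_mul, Int.cast_natCast]
        field_simp
      rw [e1, abs_mul, abs_of_pos (div_pos hB0pos hN0)]
      calc _ ≤ 1 * (B (e 0) (e 0) / N) := by
            refine mul_le_mul_of_nonneg_right ?_ (div_pos hB0pos hN0).le
            exact h1.trans (by norm_num)
        _ ≤ C * γ 0 / N := by
            rw [one_mul]
            exact div_le_div_of_nonneg_right hB0le hN0.le
    obtain ⟨P, hPS, hP⟩ := hS B e' (fun i => γ i.succ) hB
      (fun i j hij => hmono (Fin.succ_le_succ_iff.2 hij)) (fun i => hγ _) (fun x => by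
        -- In the old basis the vector only acquires a coordinate along `e 0`, whose nonnegative
        -- contribution is dropped.
        have h := hlow (Fin.cons (- ∑ l, x l * v l) x)
        simp only [Fin.sum_univ_succ, Fin.cons_zero, Fin.cons_succ] at h
        have e1 : ∑ i, x i • e' i = (- ∑ l, x l * v l) • e 0 + ∑ i, x i • e i.succ := by
          simp only [e', smul_sub, Finset.sum_sub_distrib, smul_smul, neg_smul, Finset.sum_smul]
          abel
        rw [e1]
        refine le_trans (mul_le_mul_of_nonneg_left ?_ hc.le) h
        exact le_add_of_nonneg_left (mul_nonneg (sq_nonneg _) (hγ 0).le)) (fun i j hij => by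
        have h0i : γ 0 ≤ γ i.succ := hmono (Fin.zero_le _)
        have b1 := hup i.succ j.succ (Fin.succ_le_succ_iff.2 hij)
        have b2 : ∀ l : Fin g, |B (e 0) (e l.succ)| ≤ C * γ i.succ := fun l =>
          (hup 0 l.succ (Fin.zero_le _)).trans (mul_le_mul_of_nonneg_left h0i hC0)
        have b3 : |B (e 0) (e 0)| ≤ C * γ i.succ :=
          (hup 0 0 le_rfl).trans (mul_le_mul_of_nonneg_left h0i hC0)
        have hCγ : 0 ≤ C * γ i.succ := mul_nonneg hC0 (hγ _).le
        have e1 : B (e' i) (e' j) = B (e i.succ) (e j.succ) + - (v j * B (e 0) (e i.succ)) +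
            - (v i * B (e 0) (e j.succ)) + v i * v j * B (e 0) (e 0) := by
          simp only [e', map_sub, map_smul, smul_eq_mul, LinearMap.sub_apply, LinearMap.smul_apply,
            hsymm (e i.succ) (e 0)]
          ring
        rw [e1]
        refine (abs_add_le _ _).trans ?_
        have t1 := abs_add_le (B (e i.succ) (e j.succ) + - (v j * B (e 0) (e i.succ)))
          (- (v i * B (e 0) (e j.succ)))
        have t2 := abs_add_le (B (e i.succ) (e j.succ)) (- (v j * B (e 0) (e i.succ)))
        rw [abs_neg, abs_mul] at t1 t2
        have m1 := mul_le_mul (hvD j) (b2 i) (abs_nonneg _) hD0.le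
        have m2 := mul_le_mul (hvD i) (b2 j) (abs_nonneg _) hD0.le
        have m3 := mul_le_mul (mul_le_mul (hvD i) (hvD j) (abs_nonneg _) hD0.le) b3
          (abs_nonneg _) (mul_nonneg hD0.le hD0.le)
        rw [abs_mul (v i * v j), abs_mul (v i)]
        linarith)
    refine ⟨_, ⟨w, ⟨fun l => ?_, fun l => ?_⟩, P, hPS, rfl⟩, ?_⟩
    · have := (abs_le.1 ((hw l).trans hL)).1
      exact_mod_cast this
    · have := (abs_le.1 ((hw l).trans hL)).2
      exact_mod_cast this
    have f0 : ∑ k, extendUnipotent v P k 0 • e k = e 0 := by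
      simp [Fin.sum_univ_succ]
    have fs : ∀ j : Fin g, ∑ k, extendUnipotent v P k j.succ • e k = ∑ l, P l j • e' l := by
      intro j
      simp only [Fin.sum_univ_succ, extendUnipotent_zero_succ, extendUnipotent_succ_succ, e',
        smul_sub, Finset.sum_sub_distrib, smul_smul, neg_smul, Finset.sum_smul, mul_comm (v _)]
      abel
    have h0 : ∀ j : Fin g, |B (e 0) (∑ l, P l j • e' l)| ≤ ε * γ 0 := by
      intro j
      rw [map_sum]
      refine (Finset.abs_sum_le_sum_abs _ _).trans ?_
      calc ∑ l, |B (e 0) (P l j • e' l)| ≤ ∑ _l : Fin g, K * (C * γ 0 / N) := by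
            refine Finset.sum_le_sum fun l _ => ?_
            rw [map_smul, smul_eq_mul, abs_mul]
            exact mul_le_mul (hK P hPS l j) (hcross l) (abs_nonneg _) hK0
        _ = g * (K * (C / N)) * γ 0 := by
            rw [Finset.sum_const, Finset.card_univ, Fintype.card_fin, nsmul_eq_mul]
            ring
        _ ≤ ε * γ 0 := mul_le_mul_of_nonneg_right hNε (hγ 0).le
    intro i j
    change i ≠ j → |B (∑ k, extendUnipotent v P k i • e k)
      (∑ k, extendUnipotent v P k j • e k)| ≤ ε * γ i
    refine Fin.cases ?_ (fun i => ?_) i <;> refine Fin.cases ?_ (fun j => ?_) j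
    · intro h
      exact absurd rfl h
    · intro _
      rw [f0, fs]
      exact h0 j
    · intro _
      rw [f0, fs, hsymm]
      exact (h0 i).trans (mul_le_mul_of_nonneg_left (hmono (Fin.zero_le _)) hε.le)
    · intro h
      rw [fs, fs]
      exact hP i j fun hij => h (by rw [hij])

/-! ### Gaussian sums over lattices -/

theorem summable_int_pow_sq {κ : ℝ} (h0 : 0 ≤ κ) (h1 : κ < 1) :
    Summable fun n : ℤ => κ ^ (n.natAbs ^ 2) := by
  have h : Summable fun n : ℕ => κ ^ (n ^ 2) :=
    Summable.of_nonneg_of_le (fun n => pow_nonneg h0 _)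
      (fun n => pow_le_pow_of_le_one h0 h1.le (by nlinarith [Nat.zero_le n] : n ≤ n ^ 2))
      (summable_geometric_of_lt_one h0 h1)
  exact Summable.of_nat_of_neg (by simpa using h) (by simpa using h)

theorem summable_lattice_pow_sq (g : ℕ) {κ : ℝ} (h0 : 0 ≤ κ) (h1 : κ < 1) :
    Summable fun n : Fin g → ℤ => κ ^ (∑ i, (n i).natAbs ^ 2) := by
  induction g with
  | zero => exact (hasSum_fintype _).summable
  | succ g ih =>
    rw [← (Fin.consEquiv fun _ : Fin (g + 1) => ℤ).summable_iff]
    refine ((summable_int_pow_sq h0 h1).mul_of_nonneg ih (fun _ => pow_nonneg h0 _)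
      fun _ => pow_nonneg h0 _).congr fun x => ?_
    simp [Fin.consEquiv, Fin.sum_univ_succ, pow_add]

/-! ### Decomposition of the exponents of the theta series -/

/-- The index set of the generators of the exponents of the theta series. -/
abbrev GenIndex (g : ℕ) : Type := Fin g ⊕ ((Fin g × Bool) ⊕ (Fin g × Fin g × Bool))

/-- The sign given by a boolean. -/
def boolSign (s : Bool) : ℤ := if s then 1 else -1

/-- The generators of the exponents of the theta series. -/
def gen {g : ℕ} (M : ℕ) (u ζ : Fin g → ℂ) (σ : Matrix (Fin g) (Fin g) ℂ) : GenIndex g → ℂ :=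
  Sum.elim u (Sum.elim (fun x => M * u x.1 + boolSign x.2 * ζ x.1)
    (fun x => u x.1 + boolSign x.2.2 * if x.1 = x.2.1 then 0 else σ x.1 x.2.1))

/-- The coefficient of `σ i j` in a quadratic form with values in the index with the larger
coordinate. -/
def crossCoeff {g : ℕ} (μ : Fin g → ℤ) (i j : Fin g) : ℤ :=
  if i = j then 0 else if |μ j| < |μ i| then 2 * (μ i * μ j) else
    if |μ j| = |μ i| then μ i * μ j else 0

/-- The coefficients of the diagonal generators. -/
def diagCoeff {g : ℕ} (M : ℕ) (μ : Fin g → ℤ) (i : Fin g) : ℤ :=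
  (2 * g + 2) * μ i ^ 2 - ∑ j, |crossCoeff μ i j| - M * |2 * μ i| + M ^ 2

/-- The exponents of the theta series with respect to the generators. -/
def genExponent {g : ℕ} (M : ℕ) (μ : Fin g → ℤ) : GenIndex g → ℕ :=
  Sum.elim (fun i => (diagCoeff M μ i).toNat)
    (Sum.elim (fun x => (boolSign x.2 * (2 * μ x.1)).toNat)
      (fun x => (boolSign x.2.2 * crossCoeff μ x.1 x.2.1).toNat))

section

variable {g : ℕ} (μ : Fin g → ℤ)

theorem crossCoeff_self (i : Fin g) : crossCoeff μ i i = 0 := by simp [crossCoeff]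

theorem crossCoeff_add_swap {i j : Fin g} (h : i ≠ j) :
    crossCoeff μ i j + crossCoeff μ j i = 2 * (μ i * μ j) := by
  simp only [crossCoeff, if_neg h, if_neg h.symm]
  rcases lt_trichotomy |μ i| |μ j| with h1 | h1 | h1
  · simp [h1, h1.not_gt, h1.ne']
    ring
  · simp [h1]
    ring
  · simp [h1, h1.not_gt, h1.ne']

theorem abs_crossCoeff_le (i j : Fin g) : |crossCoeff μ i j| ≤ 2 * μ i ^ 2 := by
  have h0 := sq_nonneg (μ i)
  have key : |μ j| ≤ |μ i| → |μ i * μ j| ≤ μ i ^ 2 := fun h => by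
    rw [abs_mul, ← sq_abs]
    nlinarith [abs_nonneg (μ i)]
  unfold crossCoeff
  split_ifs with h1 h2 h3
  · simpa using h0
  · rw [abs_mul]
    simpa using key h2.le
  · linarith [key h3.le]
  · simpa using h0

/-- After the cross terms are absorbed, what remains is at least `2 μ² - 2 M |μ| + M² = μ² + (|μ| -
M)²`. This is why `M ^ 2` is added; the factor in front of the series compensates for it. -/
theorem sq_le_diagCoeff (M : ℕ) (i : Fin g) : μ i ^ 2 ≤ diagCoeff M μ i := by
  have h : ∑ j, |crossCoeff μ i j| ≤ g * (2 * μ i ^ 2) := by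
    refine (Finset.sum_le_sum fun j _ => abs_crossCoeff_le μ i j).trans ?_
    simp
  have h2 := sq_nonneg (|μ i| - M)
  rw [sub_sq, sq_abs] at h2
  rw [diagCoeff, abs_mul, abs_two]
  nlinarith

theorem toNat_add_toNat_neg (x : ℤ) : (x.toNat : ℤ) + ((-x).toNat : ℤ) = |x| := by
  rcases abs_cases x with h | h <;> omega

theorem sum_bool_toNat_mul (x : ℤ) (v w : ℂ) :
    ∑ s : Bool, ((boolSign s * x).toNat : ℂ) * (v + boolSign s * w) =
      (|x| : ℤ) * v + x * w := by
  have h1 : ((x.toNat : ℤ) : ℂ) - (((-x).toNat : ℤ) : ℂ) = x := by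
    rw [← Int.cast_sub, Int.toNat_sub_toNat_neg]
  have h2 : ((x.toNat : ℤ) : ℂ) + (((-x).toNat : ℤ) : ℂ) = (|x| : ℤ) := by
    rw [← Int.cast_add, toNat_add_toNat_neg]
  simp only [Fintype.sum_bool, boolSign, if_true, one_mul, Bool.false_eq_true, if_false, neg_mul,
    Int.cast_neg, Int.cast_one]
  push_cast at h1 h2 ⊢
  linear_combination w * h1 + v * h2

/-- A real multiple of `ζ i` or `σ i j` of either sign is produced by the generator of the matching
sign, at the price of extra multiples of `u i`, which `diagCoeff` subtracts again. -/
theorem sum_genExponent_mul_gen (M : ℕ) {u ζ : Fin g → ℂ} {σ : Matrix (Fin g) (Fin g) ℂ}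
    (hσ : ∀ i j, σ i j = σ j i) (hu : ∀ i, σ i i = (2 * g + 2) * u i) :
    ∑ x, (genExponent M μ x : ℂ) * gen M u ζ σ x =
      quadForm σ (fun i => (μ i : ℂ)) + 2 * ((fun i => (μ i : ℂ)) ⬝ᵥ ζ) + M ^ 2 * ∑ i, u i := by
  have hd : ∀ i, ((diagCoeff M μ i).toNat : ℂ) = diagCoeff M μ i := fun i => by
    have h : ((diagCoeff M μ i).toNat : ℤ) = diagCoeff M μ i :=
      Int.toNat_of_nonneg ((sq_nonneg _).trans (sq_le_diagCoeff μ M i))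
    exact_mod_cast congrArg (Int.cast : ℤ → ℂ) h
  have hc : ∀ i j, ∑ s : Bool, ((boolSign s * crossCoeff μ i j).toNat : ℂ) *
      (u i + boolSign s * if i = j then 0 else σ i j) =
      (|crossCoeff μ i j| : ℤ) * u i + crossCoeff μ i j * σ i j := fun i j => by
    rw [sum_bool_toNat_mul]
    by_cases h : i = j
    · subst h
      simp [crossCoeff_self]
    · simp [h]
  have hq : quadForm σ (fun i => (μ i : ℂ)) =
      ∑ i, (μ i : ℂ) ^ 2 * σ i i + ∑ i, ∑ j, (crossCoeff μ i j : ℂ) * σ i j := by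
    have hsym : 2 * ∑ i, ∑ j, (crossCoeff μ i j : ℂ) * σ i j =
        ∑ i, ∑ j, ((crossCoeff μ i j : ℂ) + crossCoeff μ j i) * σ i j := by
      simp only [add_mul, Finset.sum_add_distrib, two_mul]
      congr 1
      rw [Finset.sum_comm]
      exact Finset.sum_congr rfl fun i _ => Finset.sum_congr rfl fun j _ => by rw [hσ]
    have hdiag : ∑ i, (μ i : ℂ) ^ 2 * σ i i =
        ∑ i, ∑ j, if i = j then (μ i : ℂ) * σ i j * μ j else 0 := by
      refine Finset.sum_congr rfl fun i _ => ?_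
      rw [Finset.sum_ite_eq, if_pos (Finset.mem_univ i)]
      ring
    have h2 : (2 : ℂ) ≠ 0 := two_ne_zero
    refine mul_left_cancel₀ h2 ?_
    rw [mul_add, hsym, hdiag, quadForm_eq_sum]
    simp only [Finset.mul_sum, ← Finset.sum_add_distrib]
    refine Finset.sum_congr rfl fun i _ => Finset.sum_congr rfl fun j _ => ?_
    by_cases h : i = j
    · subst h
      simp [crossCoeff_self]
    · have h3 : ((crossCoeff μ i j : ℤ) : ℂ) + ((crossCoeff μ j i : ℤ) : ℂ) =
          2 * (μ i * μ j) := by exact_mod_cast congrArg (Int.cast : ℤ → ℂ) (crossCoeff_add_swap μ h)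
      rw [if_neg h, h3]
      ring
  simp only [Fintype.sum_sum_type, genExponent, gen, Sum.elim_inl, Sum.elim_inr,
    Fintype.sum_prod_type, hc, sum_bool_toNat_mul, hd]
  rw [hq, dotProduct]
  simp only [diagCoeff, Finset.mul_sum, ← Finset.sum_add_distrib]
  refine Finset.sum_congr rfl fun i _ => ?_
  rw [hu, Finset.sum_add_distrib, ← Finset.sum_mul]
  push_cast
  ring

theorem sum_bool_toNat (x : ℤ) : ∑ s : Bool, ((boolSign s * x).toNat : ℝ) = (|x| : ℤ) := by
  have h2 : ((x.toNat : ℤ) : ℝ) + (((-x).toNat : ℤ) : ℝ) = (|x| : ℤ) := by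
    rw [← Int.cast_add, toNat_add_toNat_neg]
  simp only [Fintype.sum_bool, boolSign, if_true, one_mul, Bool.false_eq_true, if_false, neg_mul]
  push_cast at h2 ⊢
  exact h2

/-- The `u i` contribute at most `-δ μ i ^ 2` to the exponent. The other generators attached to `i`
have total multiplicity at most `(2g + 2) μ i ^ 2`, so radii `exp (π δ / (4g + 4)) > 1` use up only
half of this. -/
theorem prod_pow_genExponent_le (M : ℕ) {δ : ℝ} (hδ : 0 < δ) :
    ∏ x, Real.exp (Real.pi * Sum.elim (fun _ : Fin g => - δ) (fun _ => δ / (4 * g + 4)) x) ^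
      genExponent M μ x ≤ Real.exp (- (Real.pi * δ / 2)) ^ (∑ i, (μ i).natAbs ^ 2) := by
  have hdn : ∀ i, ((diagCoeff M μ i).toNat : ℝ) = diagCoeff M μ i := fun i => by
    have h : ((diagCoeff M μ i).toNat : ℤ) = diagCoeff M μ i :=
      Int.toNat_of_nonneg ((sq_nonneg _).trans (sq_le_diagCoeff μ M i))
    exact_mod_cast congrArg (Int.cast : ℤ → ℝ) h
  have hterm : ∀ i, (diagCoeff M μ i : ℝ) * (- δ) + ((|2 * μ i| : ℤ) + ∑ j, (|crossCoeff μ i j| : ℤ)) *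
      (δ / (4 * g + 4)) ≤ - δ / 2 * (μ i : ℝ) ^ 2 := by
    intro i
    have h1 : ((μ i : ℝ)) ^ 2 ≤ diagCoeff M μ i := by exact_mod_cast sq_le_diagCoeff μ M i
    have h2 : |2 * μ i| + ∑ j, |crossCoeff μ i j| ≤ (2 * g + 2) * μ i ^ 2 := by
      have h : ∑ j, |crossCoeff μ i j| ≤ g * (2 * μ i ^ 2) := by
        refine (Finset.sum_le_sum fun j _ => abs_crossCoeff_le μ i j).trans ?_
        simp
      have h3 : |2 * μ i| ≤ 2 * μ i ^ 2 := by
        rw [abs_mul, abs_two, ← sq_abs]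
        nlinarith [Int.le_self_sq |μ i|]
      linarith
    have h2' : ((|2 * μ i| : ℤ) + ∑ j, (|crossCoeff μ i j| : ℤ) : ℝ) ≤ (2 * g + 2) * (μ i : ℝ) ^ 2 := by
      exact_mod_cast h2
    have hg : (0 : ℝ) < 4 * g + 4 := by positivity
    have h4 := mul_le_mul_of_nonneg_right h2' (div_pos hδ hg).le
    have e : (2 * g + 2) * (μ i : ℝ) ^ 2 * (δ / (4 * g + 4)) = δ / 2 * (μ i : ℝ) ^ 2 := by
      field_simp
      ring
    rw [e] at h4
    nlinarith
  simp only [← Real.exp_nat_mul, ← Real.exp_sum]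
  rw [Real.exp_le_exp]
  simp only [Fintype.sum_sum_type, genExponent, Sum.elim_inl, Sum.elim_inr, Fintype.sum_prod_type,
    ← Finset.sum_mul, sum_bool_toNat, hdn]
  have h := mul_le_mul_of_nonneg_left (Finset.sum_le_sum fun i (_ : i ∈ Finset.univ) => hterm i)
    Real.pi_pos.le
  rw [← Finset.mul_sum, Finset.sum_add_distrib, ← Finset.sum_mul, ← Finset.sum_mul,
    Finset.sum_add_distrib] at h
  simp only [Int.cast_sum] at h
  have e : ((∑ i, (μ i).natAbs ^ 2 : ℕ) : ℝ) = ∑ i, (μ i : ℝ) ^ 2 := by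
    rw [Nat.cast_sum]
    refine Finset.sum_congr rfl fun i _ => ?_
    rw [Nat.cast_pow, Nat.cast_natAbs, Int.cast_abs, sq_abs]
  rw [e]
  linarith

theorem summable_prod_pow_genExponent (M : ℕ) {δ : ℝ} (hδ : 0 < δ)
    {F : (Fin g → ℤ) → (Fin g → ℤ)} (hF : Function.Injective F) :
    Summable fun n => ∏ x, Real.exp (Real.pi *
      Sum.elim (fun _ : Fin g => - δ) (fun _ => δ / (4 * g + 4)) x) ^ genExponent M (F n) x := by
  have h1 : Real.exp (- (Real.pi * δ / 2)) < 1 := by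
    rw [Real.exp_lt_one_iff]
    have := mul_pos Real.pi_pos hδ
    linarith
  exact Summable.of_nonneg_of_le
    (fun n => Finset.prod_nonneg fun _ _ => pow_nonneg (Real.exp_pos _).le _)
    (fun n => prod_pow_genExponent_le (F n) M hδ)
    ((summable_lattice_pow_sq g (Real.exp_pos _).le h1).comp_injective hF)

end

/-! ### The theta series in a transformed basis -/

theorem quadForm_mulVec {R : Type*} [CommRing R] {g : ℕ} (M Q : Matrix (Fin g) (Fin g) R)
    (x : Fin g → R) : quadForm M (Q *ᵥ x) = quadForm (Qᵀ * M * Q) x := by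
  simp only [quadForm, ← Matrix.mulVec_mulVec]
  rw [Matrix.dotProduct_mulVec x, Matrix.vecMul_transpose]

/-- The symmetric matrix `ᵗQ t Q`. -/
def transQuad {g : ℕ} (Q : Matrix (Fin g) (Fin g) ℝ) (t : Sym2 (Fin g) → ℂ) :
    Matrix (Fin g) (Fin g) ℂ :=
  (Q.map Complex.ofReal)ᵀ * symMatrix t * Q.map Complex.ofReal

/-- The vector `ᵗQ (z + t a + b)`. -/
def transVec {g : ℕ} (Q : Matrix (Fin g) (Fin g) ℝ) (a b : Fin g → ℝ)
    (p : (Fin g → ℂ) × (Sym2 (Fin g) → ℂ)) : Fin g → ℂ :=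
  (Q.map Complex.ofReal)ᵀ *ᵥ
    (p.1 + symMatrix p.2 *ᵥ (fun i => (a i : ℂ)) + fun i => (b i : ℂ))

/-- The generators of the exponents of the theta series, as functions on the domain. -/
def thetaGen {g : ℕ} (M : ℕ) (Q : Matrix (Fin g) (Fin g) ℝ) (a b : Fin g → ℝ) (x : GenIndex g)
    (p : (Fin g → ℂ) × (Sym2 (Fin g) → ℂ)) : ℂ :=
  gen M (fun i => ((2 * g + 2 : ℝ)⁻¹ : ℝ) * transQuad Q p.2 i i) (transVec Q a b p)
    (transQuad Q p.2) x

/-- The exponent of the factor in front of the theta series. -/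
def thetaFactor {g : ℕ} (M : ℕ) (Q : Matrix (Fin g) (Fin g) ℝ) (a b : Fin g → ℝ)
    (p : (Fin g → ℂ) × (Sym2 (Fin g) → ℂ)) : ℂ :=
  quadForm (symMatrix p.2) (fun i => (a i : ℂ)) +
    2 * ((fun i => (a i : ℂ)) ⬝ᵥ (p.1 + fun i => (b i : ℂ))) +
    ((- M ^ 2 : ℝ) : ℂ) * ∑ i, ((2 * g + 2 : ℝ)⁻¹ : ℝ) * transQuad Q p.2 i i

section

variable {g : ℕ} {Q : Matrix (Fin g) (Fin g) ℝ}

theorem transQuad_apply (t : Sym2 (Fin g) → ℂ) (i j : Fin g) :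
    transQuad Q t i j = ∑ l, ∑ k, ((Q k i * Q l j : ℝ) : ℂ) * t s(k, l) := by
  simp only [transQuad, Matrix.mul_apply, Matrix.transpose_apply, Matrix.map_apply, symMatrix,
    Matrix.of_apply, Finset.sum_mul]
  refine Finset.sum_congr rfl fun l _ => Finset.sum_congr rfl fun k _ => ?_
  push_cast
  ring

theorem transQuad_symm (t : Sym2 (Fin g) → ℂ) (i j : Fin g) :
    transQuad Q t i j = transQuad Q t j i := by
  rw [transQuad_apply, transQuad_apply, Finset.sum_comm]
  refine Finset.sum_congr rfl fun l _ => Finset.sum_congr rfl fun k _ => ?_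
  rw [Sym2.eq_swap, mul_comm (Q l i)]

theorem transQuad_im (t : Sym2 (Fin g) → ℂ) (i j : Fin g) :
    (transQuad Q t i j).im = (Qᵀ * symMatrix (fun e => (t e).im) * Q) i j := by
  simp only [transQuad_apply, Complex.im_sum, Complex.im_ofReal_mul, Matrix.mul_apply,
    Matrix.transpose_apply, symMatrix, Matrix.of_apply, Finset.sum_mul]
  refine Finset.sum_congr rfl fun l _ => Finset.sum_congr rfl fun k _ => ?_
  ring

theorem transVec_apply (a b : Fin g → ℝ) (p : (Fin g → ℂ) × (Sym2 (Fin g) → ℂ)) (i : Fin g) :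
    transVec Q a b p i =
      ∑ k, (Q k i : ℂ) * (p.1 k + ∑ l, (a l : ℂ) * p.2 s(k, l) + b k) := by
  simp only [transVec, Matrix.mulVec, dotProduct, Matrix.transpose_apply, Matrix.map_apply,
    symMatrix, Matrix.of_apply, Pi.add_apply]
  refine Finset.sum_congr rfl fun k _ => ?_
  simp only [mul_comm (a _ : ℂ)]

theorem transVec_im (a b : Fin g → ℝ) (p : (Fin g → ℂ) × (Sym2 (Fin g) → ℂ)) (i : Fin g) :
    (transVec Q a b p i).im =
      ∑ k, Q k i * ((p.1 k).im + ∑ l, a l * (p.2 s(k, l)).im) := by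
  simp [transVec_apply]

theorem isRealAffine_transQuad (i j : Fin g) :
    IsRealAffine fun p : (Fin g → ℂ) × (Sym2 (Fin g) → ℂ) => transQuad Q p.2 i j := by
  simp only [transQuad_apply]
  exact IsRealAffine.sum _ fun l => IsRealAffine.sum _ fun k => (IsRealAffine.snd _).smul _

theorem isRealAffine_transVec (a b : Fin g → ℝ) (i : Fin g) :
    IsRealAffine fun p : (Fin g → ℂ) × (Sym2 (Fin g) → ℂ) => transVec Q a b p i := by
  simp only [transVec_apply]
  exact IsRealAffine.sum _ fun k => (((IsRealAffine.fst k).add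
    (IsRealAffine.sum _ fun l => (IsRealAffine.snd _).smul _)).add (IsRealAffine.const _)).smul _

theorem isRealAffine_thetaGen (M : ℕ) (a b : Fin g → ℝ) (x : GenIndex g) :
    IsRealAffine (thetaGen M Q a b x) := by
  have hu : ∀ i, IsRealAffine fun p : (Fin g → ℂ) × (Sym2 (Fin g) → ℂ) =>
      ((2 * g + 2 : ℝ)⁻¹ : ℝ) * transQuad Q p.2 i i := fun i =>
    (isRealAffine_transQuad i i).smul _
  rcases x with i | ⟨i, s⟩ | ⟨i, j, s⟩
  · exact hu i
  · convert ((hu i).smul (M : ℝ)).add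
      ((isRealAffine_transVec (Q := Q) a b i).smul (boolSign s : ℝ)) using 1
    funext p
    simp [thetaGen, gen]
  · by_cases h : i = j
    · convert hu i using 1
      funext p
      simp [thetaGen, gen, h]
    · convert (hu i).add ((isRealAffine_transQuad (Q := Q) i j).smul (boolSign s : ℝ)) using 1
      funext p
      simp [thetaGen, gen, h]

theorem isRealAffine_thetaFactor (M : ℕ) (a b : Fin g → ℝ) :
    IsRealAffine (thetaFactor M Q a b) := by
  have h1 : IsRealAffine fun p : (Fin g → ℂ) × (Sym2 (Fin g) → ℂ) =>
      ∑ i, ∑ j, ((a i * a j : ℝ) : ℂ) * p.2 s(i, j) :=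
    IsRealAffine.sum _ fun i => IsRealAffine.sum _ fun j => (IsRealAffine.snd _).smul _
  have h2 : IsRealAffine fun p : (Fin g → ℂ) × (Sym2 (Fin g) → ℂ) =>
      ((2 : ℝ) : ℂ) * ∑ i, (a i : ℂ) * (p.1 i + b i) :=
    (IsRealAffine.sum _ fun i => ((IsRealAffine.fst i).add (IsRealAffine.const _)).smul _).smul _
  have h3 := (IsRealAffine.sum Finset.univ fun i : Fin g =>
    (isRealAffine_transQuad (Q := Q) i i).smul (2 * g + 2 : ℝ)⁻¹).smul (- M ^ 2 : ℝ)
  convert (h1.add h2).add h3 using 1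
  funext p
  simp only [thetaFactor, quadForm_eq_sum, symMatrix, Matrix.of_apply, dotProduct, Pi.add_apply]
  congr 2
  refine Finset.sum_congr rfl fun i _ => Finset.sum_congr rfl fun j _ => ?_
  push_cast
  ring

/-- The substitution `n = Q (A n)` identifies the two series term by term, up to the constant factor
from the `M ^ 2` shift; convergence plays no role. -/
theorem thetaChar_eq {A : Matrix (Fin g) (Fin g) ℤ}
    (hQA : Q * A.map (Int.cast : ℤ → ℝ) = 1) (M : ℕ) (a b : Fin g → ℝ)
    (p : (Fin g → ℂ) × (Sym2 (Fin g) → ℂ)) :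
    thetaChar a b p.1 p.2 = Complex.exp (Real.pi * Complex.I * thetaFactor M Q a b p) *
      ∑' n : Fin g → ℤ, ∏ x, Complex.exp (Real.pi * Complex.I * thetaGen M Q a b x p) ^
        genExponent M (A *ᵥ n) x := by
  have hg : (2 * (g : ℂ) + 2) ≠ 0 := by
    have : (2 * (g : ℝ) + 2) ≠ 0 := by positivity
    exact_mod_cast this
  have hinv : ∀ n : Fin g → ℤ, (fun i => (n i : ℂ)) =
      Q.map Complex.ofReal *ᵥ fun i => ((A *ᵥ n) i : ℂ) := by
    intro n
    have h1 : (fun i => ((A *ᵥ n) i : ℂ)) =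
        (A.map (Int.cast : ℤ → ℂ)) *ᵥ fun i => (n i : ℂ) := by
      funext i
      simp [Matrix.mulVec, dotProduct]
    have h2 : Q.map Complex.ofReal * A.map (Int.cast : ℤ → ℂ) = 1 := by
      have := congrArg (fun X : Matrix (Fin g) (Fin g) ℝ => X.map Complex.ofRealHom) hQA
      simp only [Matrix.map_mul, Matrix.map_map] at this
      rw [Matrix.map_one _ (map_zero _) (map_one _)] at this
      convert this using 2 <;> ext i j <;> simp
    rw [h1, Matrix.mulVec_mulVec, h2, Matrix.one_mulVec]
  have hexp : ∀ n : Fin g → ℤ,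
      ∑ x, (genExponent M (A *ᵥ n) x : ℂ) * thetaGen M Q a b x p =
      quadForm (symMatrix p.2) (fun i => (n i : ℂ)) + 2 * ((fun i => (n i : ℂ)) ⬝ᵥ
        (p.1 + symMatrix p.2 *ᵥ (fun i => (a i : ℂ)) + fun i => (b i : ℂ))) +
        M ^ 2 * ∑ i, ((2 * g + 2 : ℝ)⁻¹ : ℝ) * transQuad Q p.2 i i := by
    intro n
    simp only [thetaGen]
    rw [sum_genExponent_mul_gen (A *ᵥ n) M (transQuad_symm p.2) (fun i => by
      push_cast
      field_simp)]
    congr 2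
    · rw [hinv n, quadForm_mulVec]
      rfl
    · rw [hinv n, transVec, Matrix.dotProduct_mulVec _ (Q.map Complex.ofReal)ᵀ,
        Matrix.vecMul_transpose]
  have hterm : ∀ n : Fin g → ℤ, ∏ x, Complex.exp (Real.pi * Complex.I * thetaGen M Q a b x p) ^
        genExponent M (A *ᵥ n) x =
      Complex.exp (Real.pi * Complex.I * (M ^ 2 * ∑ i, ((2 * g + 2 : ℝ)⁻¹ : ℝ) *
        transQuad Q p.2 i i)) * Complex.exp (Real.pi * Complex.I *
        (quadForm (symMatrix p.2) (fun i => (n i : ℂ)) + 2 * ((fun i => (n i : ℂ)) ⬝ᵥ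
        (p.1 + symMatrix p.2 *ᵥ (fun i => (a i : ℂ)) + fun i => (b i : ℂ))))) := by
    intro n
    simp only [← Complex.exp_nat_mul]
    rw [← Complex.exp_sum, ← Complex.exp_add]
    congr 1
    rw [← mul_add, add_comm (_ * ∑ i, _), ← hexp n, Finset.mul_sum]
    exact Finset.sum_congr rfl fun x _ => by ring
  simp only [hterm]
  rw [tsum_mul_left, ← mul_assoc, ← Complex.exp_add, ← mul_add, thetaChar, theta]
  congr 3
  rw [thetaFactor]
  push_cast
  ring

end

/-! ### Definable open neighbourhoods attached to a nearly orthogonal basis -/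

theorem IsRealAffine.exists_abs_re_le {α β : Type*} [Fintype α] [Fintype β]
    {l : (α → ℂ) × (β → ℂ) → ℂ} (h : IsRealAffine l) (R : ℝ) :
    ∃ K : ℝ, ∀ p : (α → ℂ) × (β → ℂ), (∀ i, |(p.1 i).re| ≤ R) → (∀ j, |(p.2 j).re| ≤ R) →
      |(l p).re| ≤ K := by
  obtain ⟨c, d, r, h⟩ := h
  refine ⟨∑ i, |c i| * R + ∑ j, |d j| * R + |r|, fun p h1 h2 => ?_⟩
  simp only [h, Complex.add_re, Complex.re_sum, Complex.re_ofReal_mul, Complex.ofReal_re]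
  refine (abs_add_le _ _).trans (add_le_add_left ((abs_add_le _ _).trans (add_le_add ?_ ?_)) _)
  · refine (Finset.abs_sum_le_sum_abs _ _).trans (Finset.sum_le_sum fun i _ => ?_)
    rw [abs_mul]
    exact mul_le_mul_of_nonneg_left (h1 i) (abs_nonneg _)
  · refine (Finset.abs_sum_le_sum_abs _ _).trans (Finset.sum_le_sum fun i _ => ?_)
    rw [abs_mul]
    exact mul_le_mul_of_nonneg_left (h2 i) (abs_nonneg _)

/-- A symmetric matrix whose rows are dominated by the diagonal is positive definite. -/
theorem quadForm_pos_of_dominant {g : ℕ} {S : Matrix (Fin g) (Fin g) ℝ} {u : Fin g → ℝ}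
    (hsymm : ∀ i j, S i j = S j i) (hu : ∀ i, 0 < u i) (hdiag : ∀ i, S i i = (2 * g + 2) * u i)
    (hoff : ∀ i j, i ≠ j → |S i j| ≤ 2 * u i) {x : Fin g → ℝ} (hx : x ≠ 0) :
    0 < quadForm S x := by
  have hterm : ∀ i j, (if i = j then (2 * g + 2) * u i * x i ^ 2 else 0) - (u i * x i ^ 2 +
      u j * x j ^ 2) ≤ x i * S i j * x j := by
    intro i j
    by_cases h : i = j
    · subst h
      rw [if_pos rfl, hdiag]
      nlinarith [mul_nonneg (hu i).le (sq_nonneg (x i))]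
    · rw [if_neg h]
      have h1 := hoff i j h
      have h2 := hoff j i (Ne.symm h)
      rw [← hsymm] at h2
      have h3 : |x i * S i j * x j| = |S i j| * (|x i| * |x j|) := by
        rw [abs_mul, abs_mul]
        ring
      have h4 : |x i| * |x j| ≤ (x i ^ 2 + x j ^ 2) / 2 := by
        rw [← sq_abs (x i), ← sq_abs (x j)]
        nlinarith [sq_nonneg (|x i| - |x j|)]
      have h5 := neg_abs_le (x i * S i j * x j)
      have h6 := mul_le_mul_of_nonneg_left h4 (abs_nonneg (S i j))
      have h7 := mul_le_mul_of_nonneg_right h1 (sq_nonneg (x i))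
      have h8 := mul_le_mul_of_nonneg_right h2 (sq_nonneg (x j))
      rw [h3] at h5
      linarith
  have hsum := Finset.sum_le_sum fun i (_ : i ∈ Finset.univ) =>
    Finset.sum_le_sum fun j (_ : j ∈ Finset.univ) => hterm i j
  rw [← quadForm_eq_sum] at hsum
  have e : ∑ i, ∑ j, ((if i = j then (2 * g + 2) * u i * x i ^ 2 else 0) - (u i * x i ^ 2 +
      u j * x j ^ 2)) = 2 * ∑ i, u i * x i ^ 2 := by
    simp only [Finset.sum_sub_distrib, Finset.sum_add_distrib, Finset.sum_ite_eq, Finset.mem_univ,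
      if_true, Finset.sum_const, Finset.card_univ, Fintype.card_fin, nsmul_eq_mul,
      ← Finset.mul_sum, mul_assoc]
    ring
  rw [e] at hsum
  obtain ⟨i, hi⟩ := Function.ne_iff.1 hx
  have hpos : 0 < ∑ i, u i * x i ^ 2 :=
    Finset.sum_pos' (fun i _ => mul_nonneg (hu i).le (sq_nonneg _))
      ⟨i, Finset.mem_univ i, mul_pos (hu i) (by have : x i ≠ 0 := hi
                                                positivity)⟩
  linarith

theorem thetaGen_inl_im {g : ℕ} (M : ℕ) (Q : Matrix (Fin g) (Fin g) ℝ) (a b : Fin g → ℝ)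
    (p : (Fin g → ℂ) × (Sym2 (Fin g) → ℂ)) (i : Fin g) :
    (thetaGen M Q a b (.inl i) p).im =
      (2 * g + 2 : ℝ)⁻¹ * (Qᵀ * symMatrix (fun e => (p.2 e).im) * Q) i i := by
  rw [← transQuad_im]
  exact Complex.im_ofReal_mul _ _

theorem thetaGen_vec_im {g : ℕ} (M : ℕ) (Q : Matrix (Fin g) (Fin g) ℝ) (a b : Fin g → ℝ)
    (p : (Fin g → ℂ) × (Sym2 (Fin g) → ℂ)) (i : Fin g) (s : Bool) :
    (thetaGen M Q a b (.inr (.inl (i, s))) p).im =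
      M * (thetaGen M Q a b (.inl i) p).im + boolSign s * (transVec Q a b p i).im := by
  simp [thetaGen, gen]

theorem thetaGen_quad_im {g : ℕ} (M : ℕ) (Q : Matrix (Fin g) (Fin g) ℝ) (a b : Fin g → ℝ)
    (p : (Fin g → ℂ) × (Sym2 (Fin g) → ℂ)) (i j : Fin g) (s : Bool) :
    (thetaGen M Q a b (.inr (.inr (i, j, s))) p).im =
      (thetaGen M Q a b (.inl i) p).im +
        boolSign s * if i = j then 0 else (Qᵀ * symMatrix (fun e => (p.2 e).im) * Q) i j := by
  rw [← transQuad_im]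
  split_ifs with h <;> simp [thetaGen, gen, h]

theorem posDef_of_transformed {g : ℕ} {Q A : Matrix (Fin g) (Fin g) ℝ} (hQA : Q * A = 1)
    {b : Sym2 (Fin g) → ℝ} {u : Fin g → ℝ} (hu : ∀ i, 0 < u i)
    (hdiag : ∀ i, (Qᵀ * symMatrix b * Q) i i = (2 * g + 2) * u i)
    (hoff : ∀ i j, i ≠ j → |(Qᵀ * symMatrix b * Q) i j| ≤ 2 * u i) : (symMatrix b).PosDef := by
  have hsymm : (symMatrix b)ᵀ = symMatrix b := by
    ext i j
    simp [symMatrix, Sym2.eq_swap]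
  refine Matrix.PosDef.of_dotProduct_mulVec_pos (by
    rw [Matrix.IsHermitian, Matrix.conjTranspose_eq_transpose_of_trivial, hsymm]) fun x hx => ?_
  have h1 : x = Q *ᵥ (A *ᵥ x) := by rw [Matrix.mulVec_mulVec, hQA, Matrix.one_mulVec]
  have h2 : A *ᵥ x ≠ 0 := fun h => hx (by rw [h1, h, Matrix.mulVec_zero])
  have hT : (Qᵀ * symMatrix b * Q)ᵀ = Qᵀ * symMatrix b * Q := by
    simp [Matrix.transpose_mul, hsymm, Matrix.mul_assoc]
  have h3 := quadForm_pos_of_dominant (fun i j => (congrFun (congrFun hT i) j).symm) hu hdiag hoff h2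
  rw [← quadForm_mulVec, ← h1] at h3
  simpa [quadForm] using h3

/-- `U` is the region where the generators satisfy strict bounds weaker than those holding at the
given points, yet strong enough for convergence and for positivity of `Im τ`. -/
theorem exists_definable_neighborhood {g : ℕ} [NeZero g] {P : Matrix (Fin g) (Fin g) ℝ}
    (hP : IsRatUnipotent P) (a b : Fin g → ℝ) {c m d : ℝ} (R : ℝ) (hc : 0 < c) (hm : 0 < m)
    (hd : 0 < d) :
    ∃ U : Set ((Fin g → ℂ) × (Sym2 (Fin g) → ℂ)), IsOpen U ∧ U ⊆ {p | p.2 ∈ siegel g} ∧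
      DefinableOn (thetaChar a b) U ∧ ∀ p : (Fin g → ℂ) × (Sym2 (Fin g) → ℂ),
        (∀ i, |(p.1 i).re| ≤ R) → (∀ j, |(p.2 j).re| ≤ R) →
        ∀ β : Matrix (Fin g) (Fin g) ℝ, β = symMatrix (fun e => (p.2 e).im) → IsReduced β →
          d ≤ β 0 0 → (∀ i, |(p.1 i).im| ≤ m * β i i) →
          (∀ x : Fin g → ℝ, c * ∑ i, x i ^ 2 * β i i ≤ quadForm β x) →
          (∀ i j, i ≠ j → |(Pᵀ * β * P) i j| ≤ c / (2 * g + 2) * β i i) → p ∈ U := by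
  obtain ⟨N, A, hN, hAP⟩ := hP.exists_inverse
  have hN0 : (N : ℝ) ≠ 0 := by exact_mod_cast hN
  set Q : Matrix (Fin g) (Fin g) ℝ := (N : ℝ)⁻¹ • P with hQ
  set A' : Matrix (Fin g) (Fin g) ℝ := A.map (Int.cast : ℤ → ℝ) with hA'
  have hAQ : A' * Q = 1 := by
    rw [hQ, Matrix.mul_smul, hAP, smul_smul, inv_mul_cancel₀ hN0, one_smul]
  have hQA : Q * A' = 1 := mul_eq_one_comm.1 hAQ
  have hinj : Function.Injective fun n : Fin g → ℤ => A *ᵥ n := by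
    intro n n' h
    have h1 : ∀ n : Fin g → ℤ, (fun i => (n i : ℝ)) = Q *ᵥ fun i => ((A *ᵥ n) i : ℝ) := by
      intro n
      have h2 : (fun i => ((A *ᵥ n) i : ℝ)) = A' *ᵥ fun i => (n i : ℝ) := by
        funext i
        simp [hA', Matrix.mulVec, dotProduct]
      rw [h2, Matrix.mulVec_mulVec, hQA, Matrix.one_mulVec]
    have h3 : (fun i => (n i : ℝ)) = fun i => (n' i : ℝ) := by
      rw [h1 n, h1 n', show A *ᵥ n = A *ᵥ n' from h]
    funext i
    exact_mod_cast congrFun h3 i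
  have hg : (0 : ℝ) < 2 * g + 2 := by positivity
  have hN2 : (0 : ℝ) < N ^ 2 := by positivity
  -- `κ * β i i` is the lower bound for `Im u i`: `N ^ 2` comes from `Q = P / N`, and `2g + 2` from
  -- the definition of `u i`.
  set κ : ℝ := c / (N ^ 2 * (2 * g + 2)) with hκ
  have hκ0 : 0 < κ := by positivity
  set δ : ℝ := κ * d / 4 with hδ
  have hδ0 : 0 < δ := by positivity
  set m' : ℝ := m + ∑ l, |a l| with hm'
  have hm'0 : 0 ≤ m' := by positivity
  set T : ℝ := (∑ i, ∑ k, |Q k i|) * m' with hT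
  -- Since `|Im ζ i| ≤ T * β i i`, this `M` makes the imaginary parts of `M u i ± ζ i` nonnegative.
  obtain ⟨M, hM⟩ := exists_nat_ge (T / κ)
  have hMκ : T ≤ M * κ := by rwa [div_le_iff₀ hκ0] at hM
  choose K hK using fun x => (isRealAffine_thetaGen (Q := Q) M a b x).exists_abs_re_le R
  obtain ⟨K₀, hK₀⟩ := (isRealAffine_thetaFactor (Q := Q) M a b).exists_abs_re_le R
  set R' : ℝ := ∑ x, |K x| + |K₀| + 1 with hR'
  have hR'0 : 0 < R' := by positivity
  -- At the given points `Im u i ≥ 4 δ` and the other imaginary parts are nonnegative, so the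
  -- conditions `> 2 δ` and `> -δ / (8g + 8)` hold strictly, while staying strictly inside the radii
  -- of convergence.
  let lam : GenIndex g → ℝ := Sum.elim (fun _ => - (2 * δ)) (fun _ => δ / (8 * g + 8))
  have hlam : ∀ x, lam x < Sum.elim (fun _ : Fin g => - δ) (fun _ => δ / (4 * g + 4)) x := by
    rintro (i | x)
    · simp only [lam, Sum.elim_inl]
      linarith
    · simp only [lam, Sum.elim_inr]
      exact div_lt_div_of_pos_left hδ0 (by positivity) (by
        have : (0 : ℝ) ≤ g := g.cast_nonneg
        linarith)
  have h8 : 0 < δ / (8 * (g : ℝ) + 8) := by positivity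
  have h8' : δ / (8 * (g : ℝ) + 8) ≤ δ := div_le_self hδ0.le (by
    have : (0 : ℝ) ≤ g := g.cast_nonneg
    linarith)
  obtain ⟨hopen, hdef⟩ := definableOn_exp_mul_tsum (isRealAffine_thetaFactor (Q := Q) M a b)
    (isRealAffine_thetaGen (Q := Q) M a b) (fun n : Fin g → ℤ => genExponent M (A *ᵥ n)) hlam
    (summable_prod_pow_genExponent M hδ0 hinj) hR'0 (f := thetaChar a b) rfl
    (fun p _ => thetaChar_eq hQA M a b p)
  refine ⟨_, hopen, ?_, hdef, ?_⟩
  · rintro p ⟨hp, -⟩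
    -- On `U` both signs of `u i ± σ i j` give `|Im σ i j| < Im u i + δ / (8g + 8) ≤ 2 Im u i`,
    -- against the diagonal entry `(2g + 2) Im u i`.
    refine posDef_of_transformed hQA (u := fun i => (thetaGen M Q a b (.inl i) p).im)
      (fun i => ?_) (fun i => ?_) fun i j hij => ?_
    · have h := (hp (.inl i)).1
      simp only [lam, Sum.elim_inl] at h
      linarith
    · rw [thetaGen_inl_im]
      field_simp
    · have hi := (hp (.inl i)).1
      have h1 := (hp (.inr (.inr (i, j, true)))).1
      have h2 := (hp (.inr (.inr (i, j, false)))).1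
      rw [thetaGen_quad_im, if_neg hij] at h1 h2
      simp only [lam, Sum.elim_inl, Sum.elim_inr, boolSign, if_true, Bool.false_eq_true, if_false,
        Int.cast_one, Int.cast_neg] at hi h1 h2
      exact abs_le.2 ⟨by linarith, by linarith⟩
  · intro p hp1 hp2 β hβ hred hβd hy hlow hoff
    have hS : Qᵀ * β * Q = ((N : ℝ) ^ 2)⁻¹ • (Pᵀ * β * P) := by
      rw [hQ, Matrix.transpose_smul, Matrix.smul_mul, Matrix.smul_mul, Matrix.mul_smul, smul_smul,
        pow_two, mul_inv]
    have hdiag : ∀ i, κ * β i i ≤ (thetaGen M Q a b (.inl i) p).im := by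
      intro i
      have h1 := hlow (P *ᵥ Pi.single i 1)
      rw [quadForm_mulVec, quadForm_single] at h1
      have h2 : β i i ≤ ∑ k, (P *ᵥ Pi.single i 1) k ^ 2 * β k k := by
        refine le_of_eq_of_le ?_ (Finset.single_le_sum
          (f := fun k => (P *ᵥ Pi.single i 1) k ^ 2 * β k k)
          (fun k _ => mul_nonneg (sq_nonneg _) (hred.pos k).le) (Finset.mem_univ i))
        simp [hP.diag]
      have h3 := mul_le_mul_of_nonneg_left h2 hc.le
      rw [thetaGen_inl_im, ← hβ, hS, Matrix.smul_apply, smul_eq_mul, hκ]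
      have h4 : c * β i i ≤ (Pᵀ * β * P) i i := by linarith
      calc c / (N ^ 2 * (2 * g + 2)) * β i i
          = (2 * g + 2 : ℝ)⁻¹ * ((N ^ 2 : ℝ)⁻¹ * (c * β i i)) := by field_simp
        _ ≤ _ := by gcongr
    have hre : ∀ x, |(thetaGen M Q a b x p).re| < R' := fun x => by
      have h1 := Finset.single_le_sum (f := fun x => |K x|) (fun x _ => abs_nonneg _)
        (Finset.mem_univ x)
      have h2 := hK x p hp1 hp2
      have h3 := le_abs_self (K x)
      have h4 := abs_nonneg K₀
      linarith
    have hre₀ : |(thetaFactor M Q a b p).re| < R' := by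
      have h1 : 0 ≤ ∑ x, |K x| := Finset.sum_nonneg fun x _ => abs_nonneg _
      have h2 := hK₀ p hp1 hp2
      have h3 := le_abs_self K₀
      linarith
    have hsign : ∀ (s : Bool) (v w : ℝ), |w| ≤ v → 0 ≤ v + boolSign s * w := by
      intro s v w h
      have := abs_le.1 h
      cases s <;> simp [boolSign] <;> linarith
    refine ⟨fun x => ⟨?_, hre x⟩, hre₀⟩
    rcases x with i | ⟨i, s⟩ | ⟨i, j, s⟩
    · simp only [lam, Sum.elim_inl, neg_neg]
      have h1 := mul_le_mul_of_nonneg_left (hβd.trans (hred.mono (Fin.zero_le i))) hκ0.le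
      have h2 := hdiag i
      simp only at h1
      linarith
    · simp only [lam, Sum.elim_inr]
      rw [thetaGen_vec_im]
      refine lt_of_lt_of_le (neg_neg_of_pos h8) (hsign s _ _ ?_)
      have hz : |(transVec Q a b p i).im| ≤ T * β i i := by
        rw [transVec_im]
        refine (Finset.abs_sum_le_sum_abs _ _).trans ?_
        calc ∑ k, |Q k i * ((p.1 k).im + ∑ l, a l * (p.2 s(k, l)).im)|
            ≤ ∑ k, |Q k i| * (m' * β i i) := by
              refine Finset.sum_le_sum fun k _ => ?_
              rw [abs_mul]
              -- Triangularity leaves only `k ≤ i`, where `β k k ≤ β i i`; otherwise `Im z k` could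
              -- not be bounded in terms of `β i i`.
              by_cases hik : i < k
              · simp [hQ, hP.lower k i hik]
              · refine mul_le_mul_of_nonneg_left ?_ (abs_nonneg _)
                have hk : β k k ≤ β i i := hred.mono (not_lt.1 hik)
                refine le_trans ?_ (mul_le_mul_of_nonneg_left hk hm'0)
                rw [hm', add_mul, Finset.sum_mul]
                refine (abs_add_le _ _).trans (add_le_add (hy k) ?_)
                refine (Finset.abs_sum_le_sum_abs _ _).trans (Finset.sum_le_sum fun l _ => ?_)
                rw [abs_mul]
                refine mul_le_mul_of_nonneg_left ?_ (abs_nonneg _)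
                have := hred.abs_le k l
                rw [hβ] at this ⊢
                exact this
          _ = (∑ k, |Q k i|) * m' * β i i := by
              rw [← Finset.sum_mul, mul_assoc]
          _ ≤ T * β i i := by
              rw [hT]
              refine mul_le_mul_of_nonneg_right (mul_le_mul_of_nonneg_right ?_ hm'0)
                (hred.pos i).le
              exact Finset.single_le_sum (f := fun i => ∑ k, |Q k i|)
                (fun i _ => Finset.sum_nonneg fun k _ => abs_nonneg _) (Finset.mem_univ i)
      have h1 := mul_le_mul_of_nonneg_right hMκ (hred.pos i).le
      have h2 := mul_le_mul_of_nonneg_left (hdiag i) M.cast_nonneg (α := ℝ)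
      linarith
    · simp only [lam, Sum.elim_inr]
      rw [thetaGen_quad_im]
      refine lt_of_lt_of_le (neg_neg_of_pos h8) (hsign s _ _ ?_)
      have h0 : 0 ≤ κ * β i i := mul_nonneg hκ0.le (hred.pos i).le
      split_ifs with hij
      · rw [abs_zero]
        exact h0.trans (hdiag i)
      · refine le_trans ?_ (hdiag i)
        rw [← hβ, hS, Matrix.smul_apply, smul_eq_mul, abs_mul, abs_of_pos (inv_pos.2 hN2)]
        calc ((N : ℝ) ^ 2)⁻¹ * |(Pᵀ * β * P) i j|
            ≤ ((N : ℝ) ^ 2)⁻¹ * (c / (2 * g + 2) * β i i) :=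
              mul_le_mul_of_nonneg_left (hoff i j hij) (inv_pos.2 hN2).le
          _ = κ * β i i := by rw [hκ]; field_simp

end ThetaDef


/-! ### Covering the truncated tube -/

theorem mainTheorem5 (g : ℕ) [NeZero g] (a b : Fin g → ℝ) (m d R : ℝ)
    (hm : 0 < m) (hd : 0 < d) (hR : 0 < R) :
    ∃ U : Set ((Fin g → ℂ) × (Sym2 (Fin g) → ℂ)),
      IsOpen U ∧
      U ⊆ {p | p.2 ∈ ThetaDef.siegel g} ∧
      ThetaDef.truncTube R (ThetaDef.coneCGe g m d) ⊆ U ∧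
      ThetaDef.DefinableOn (ThetaDef.thetaChar a b) U := by
  obtain ⟨c, hc, hlow⟩ := ThetaDef.exists_lower_bound g
  -- The constant `1` is the reducedness bound `|β i j| ≤ β i i`. With `ε = c / (2g + 2)` the
  -- off-diagonal entries do not exceed the lower bound for the diagonal entries divided by `2g +
  -- 2`, that is, for `Im u i`.
  obtain ⟨S, hSfin, hSu, hS⟩ := ThetaDef.exists_finite_nearly_orthogonal (V := Fin g → ℝ) g c 1
    (c / (2 * g + 2)) hc (by positivity)
  choose! U hopen hsub hdef hmem using fun P (hP : P ∈ S) =>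
    ThetaDef.exists_definable_neighborhood (hSu P hP) a b R hc hm hd
  have : Finite S := hSfin
  refine ⟨⋃ P : S, U P, isOpen_iUnion fun P => hopen P P.2, Set.iUnion_subset fun P => hsub P P.2,
    ?_, ThetaDef.DefinableOn.iUnion fun P : S => hdef P P.2⟩
  rintro p ⟨hp1, hp2, ⟨hcone, hy⟩, hd0⟩
  set β := ThetaDef.symMatrix fun e => (p.2 e).im with hβ
  have hred : ThetaDef.IsReduced β :=
    ThetaDef.isReduced_of_mem_minkowskiCone hcone (hd.trans_le hd0)
  have hB : ∀ x y : Fin g → ℝ, Matrix.toBilin' β x y = x ⬝ᵥ (β *ᵥ y) := fun x y =>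
    Matrix.toBilin'_apply' β x y
  have hsum : ∀ x : Fin g → ℝ, ∑ i, x i • (Pi.single i 1 : Fin g → ℝ) = x := fun x =>
    funext fun j => by simp [Finset.sum_apply, Pi.single_apply]
  obtain ⟨P, hP, hPB⟩ := hS (Matrix.toBilin' β) (fun i => Pi.single i 1) (fun i => β i i)
    ⟨fun x y => by
      have hT : βᵀ = β := Matrix.ext fun i j => hred.symm j i
      rw [hB, hB, Matrix.dotProduct_mulVec, ← Matrix.mulVec_transpose, hT, dotProduct_comm]⟩
    hred.mono hred.pos (fun x => by
      rw [hsum, hB]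
      exact hlow β hred x) (fun i j _ => by
      rw [hB]
      simpa using hred.abs_le i j)
  refine Set.mem_iUnion.2 ⟨⟨P, hP⟩, hmem P hP p hp1 hp2 β rfl hred hd0 hy (hlow β hred)
    fun i j hij => ?_⟩
  have h := hPB i j hij
  rw [hsum, hsum, hB] at h
  convert h using 2
  simp only [Matrix.mul_apply, Matrix.transpose_apply, dotProduct, Matrix.mulVec, Finset.sum_mul,
    Finset.mul_sum]
  rw [Finset.sum_comm]
  exact Finset.sum_congr rfl fun k _ => Finset.sum_congr rfl fun l _ => by ring

end
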